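/- Let $k\ge -\tfrac12$ and $d\mu_k(x)=\frac{|x|^{2k+1}}{2^{k+1}\Gamma(k+1)}\,dx$ on $\mathbb{R}$, and write $L^p_k=L^p(\mathbb{R},\mu_k)$ (complex-valued functions). Put $j_k(x)=\Gamma(k+1)\sum_{n\ge 0}\frac{(-1)^n(x/2)^{2n}}{n!\,\Gamma(n+k+1)}$ and, for real $\lambda,x$, let $E_k(-i\lambda,x)=j_k(-\lambda x)+\frac{(-i\lambda)x}{2(k+1)}\,j_{k+1}(-\lambda x)$ be the Dunkl kernel. Let $M=\begin{pmatrix}a&b\\c&d\end{pmatrix}\in SL(2,\mathbb{R})$ with $b\ne 0$. The linear canonical Dunkl transform of $f\in L^1_k$ is $$D_k^M f(\lambda)=\frac{1}{(ib)^{k+1}}\int_{\mathbb{R}}f(x)\,e^{\frac i2\left(\frac db\lambda^2+\frac ab x^2\right)}E_k(-i\lambda/b,x)\,d\mu_k(x),$$ and for $1<p\le 2$, with conjugate exponent $q$, $D_k^M$ also denotes its extension by continuity from $L^1_k\cap L^p_k$ to a bounded operator $L^p_k\to L^q_k$. **Theorem (Nash-type inequality).** Let $1<p_1<p_2\le 2$,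 with conjugate exponents $q_1,q_2$, and let $f\in L^{p_1}_k\cap L^{p_2}_k$. Then $D_k^M f$ is well defined: the extensions to $L^{p_1}_k$ and to $L^{p_2}_k$ both determine a unique image of $f$, and these two images agree almost everywhere. Moreover, for every $s>0$, $$\|D_k^M f\|_{L^{q_2}_k}\le C(q_1,q_2,k,b)\,\|f\|_{L^{p_1}_k}^{\theta}\,\big\||x|^s D_k^M f\big\|_{L^{q_2}_k}^{1-\theta},\qquad \theta=\frac{s q_1q_2}{(2k+2)(q_1-q_2)+s q_1q_2},$$ where $$C(q_1,q_2,k,b)=\left\{1+\left(\frac{1}{2^{k+1}\Gamma(k+2)}\right)^{\frac{q_1-q_2}{q_1}}\left(\frac{1}{|b|^{k+1}}\right)^{\left(1-\frac2{q_1}\right)q_2}\right\}^{1/q_2}.$$ (If $\||x|^sD_k^Mf\|_{L^{q_2}_k}=\infty$, the inequality is read in $[0,\infty]$ with $0\cdot\infty=0$.) -/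

import Mathlib

open scoped ENNReal Topology Nat

noncomputable section

/-- The measure `dμ_k(x) = |x|^(2k+1) / (2^(k+1) Γ(k+1)) dx` on the real line. -/
def dunklMeasure (k : ℝ) : MeasureTheory.Measure ℝ :=
  MeasureTheory.volume.withDensity fun x : ℝ =>
    ENNReal.ofReal (|x| ^ (2 * k + 1) / ((2 : ℝ) ^ (k + 1) * Real.Gamma (k + 1)))

/-- The normalized spherical Bessel function
`j_k(x) = Γ(k+1) ∑ₙ (-1)ⁿ (x/2)^(2n) / (n! Γ(n+k+1))`. -/
def normalizedBessel (k x : ℝ) : ℝ :=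
  Real.Gamma (k + 1) *
    ∑' n : ℕ, (-1 : ℝ) ^ n * (x / 2) ^ (2 * n) / ((n ! : ℝ) * Real.Gamma ((n : ℝ) + k + 1))

/-- The Dunkl kernel `E_k(-iξ, x) = j_k(-ξx) + ((-iξ)x / (2(k+1))) j_{k+1}(-ξx)`,
for real `ξ` and `x`. -/
def dunklKernel (k ξ x : ℝ) : ℂ :=
  (normalizedBessel k (-ξ * x) : ℂ) +
    (-Complex.I * (ξ : ℂ)) * (x : ℂ) / (2 * ((k : ℂ) + 1)) *
      (normalizedBessel (k + 1) (-ξ * x) : ℂ)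

/-- The kernel `E_k^M(ξ, x) = exp((i/2)((d/b) ξ² + (a/b) x²)) E_k(-iξ/b, x)`
for `M = (a, b; c, d)` with `b ≠ 0`. -/
def lcdtKernel (k : ℝ) (M : Matrix.SpecialLinearGroup (Fin 2) ℝ) (ξ x : ℝ) : ℂ :=
  Complex.exp (Complex.I / 2 *
      (((M 1 1 / M 0 1 * ξ ^ 2 + M 0 0 / M 0 1 * x ^ 2 : ℝ)) : ℂ)) *
    dunklKernel k (ξ / M 0 1) x

/-- The linear canonical Dunkl transform of a `μ_k`-integrable function. -/
def lcdt (k : ℝ) (M : Matrix.SpecialLinearGroup (Fin 2) ℝ) (f : ℝ → ℂ) (ξ : ℝ) : ℂ :=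
  if M 0 1 = 0 then
    Complex.exp (Complex.I * ((M 1 0 / (2 * M 0 0) * ξ ^ 2 : ℝ) : ℂ)) /
      ((|M 0 0| ^ (k + 1) : ℝ) : ℂ) * f (ξ / M 0 0)
  else
    1 / (Complex.I * ((M 0 1 : ℝ) : ℂ)) ^ ((k : ℂ) + 1) *
      ∫ x, f x * lcdtKernel k M ξ x ∂(dunklMeasure k)

/-- For `M = (a, b; c, d)` with `b ≠ 0` and conjugate exponents `p`, `q`: the function `g` is
(a representative of) the value at `f` of the extension by continuity of the linear canonical
Dunkl transform from `L¹_k ∩ L^p_k` to an operator from `L^p_k` to `L^q_k`. -/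
def IsLpLCDT (k : ℝ) (M : Matrix.SpecialLinearGroup (Fin 2) ℝ) (p q : ℝ) (f g : ℝ → ℂ) : Prop :=
  MeasureTheory.MemLp f (ENNReal.ofReal p) (dunklMeasure k) ∧
  MeasureTheory.MemLp g (ENNReal.ofReal q) (dunklMeasure k) ∧
  ∃ u : ℕ → ℝ → ℂ,
    (∀ n, MeasureTheory.Integrable (u n) (dunklMeasure k) ∧
      MeasureTheory.MemLp (u n) (ENNReal.ofReal p) (dunklMeasure k)) ∧
    Filter.Tendsto
      (fun n => MeasureTheory.eLpNorm (fun x => u n x - f x) (ENNReal.ofReal p) (dunklMeasure k))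
      Filter.atTop (𝓝 0) ∧
    Filter.Tendsto
      (fun n => MeasureTheory.eLpNorm (fun ξ => lcdt k M (u n) ξ - g ξ) (ENNReal.ofReal q)
        (dunklMeasure k))
      Filter.atTop (𝓝 0)

/-- The constant
`{1 + (1 / (2^(k+1) Γ(k+2)))^((q₁-q₂)/q₁) (1 / |b|^(k+1))^((1-2/q₁) q₂)}^(1/q₂)`. -/
def nashConst (q₁ q₂ k b : ℝ) : ℝ :=
  (1 + (1 / ((2 : ℝ) ^ (k + 1) * Real.Gamma (k + 2))) ^ ((q₁ - q₂) / q₁) *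
    (1 / |b| ^ (k + 1)) ^ ((1 - 2 / q₁) * q₂)) ^ (1 / q₂)

end

/-!
The inequality comes from splitting `‖D f‖_{q₂}` at a radius `r`. On `[-r, r]` Hölder's inequality
bounds it by `‖D f‖_{q₁}` times a power of `μ_k([-r, r]) = r^{2k+2} / (2^{k+1} Γ(k+2))`, and
`‖D f‖_{q₁}` is controlled by `‖f‖_{p₁}` through the Hausdorff–Young inequality with constant
`(|b|^{-(k+1)})^{1 - 2/q₁}`. Outside `[-r, r]` the weight `|x|^s` gains `r^{-s}`. The radius which
makes the two powers of `r` balance gives the stated constant (`le_of_forall_radius_le`).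

Hausdorff–Young (`eLpNorm_lcdt_le`) is the Riesz–Thorin interpolation (`IsL1L2Bounded.eLpNorm_le`)
between two endpoints, which the chirps and the dilation in `lcdt_eq` reduce to the Dunkl transform.

* `L¹ → L^∞` follows from `|E_k(-iξ, x)| ≤ 1`. With `u + iv` for the kernel,
  Bessel's equation makes `u² + v²` decrease away from `0`, where it equals `1`
  (`normalizedBessel_sq_add_dunklOddPart_sq_le`). This covers all `k ≥ -1/2` without an integral
  representation.
* `L² → L²` (`eLpNorm_two_dunklTransform_le`). Integrating the Bessel series termwise shows that the
  span of the functions `exp(-t x²)` and `x exp(-t x²)` is preserved, and that applying the transform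
  twice is the reflection `g ↦ g(-·)` there. As the kernel is symmetric, Fubini turns this inversion
  formula into an isometry on the span. A function orthogonal to all these Gaussians vanishes
  (`ae_eq_zero_of_integral_gaussianAtom`), because the moments of the bounded function `exp(-x²)`
  determine a density. This gives at once the density of the span in `L²` and the agreement of the
  integral with the `L²` limit.

Since Hausdorff–Young holds for every function in `L¹ ∩ L^p`, the extension to `L^p` exists and is
unique. Simple functions that approximate `f` in `L^{p₁}` and `L^{p₂}` simultaneously show that the
two extensions agree.
-/

open MeasureTheory Filter Set
open scoped ComplexConjugate

/-! ### The Bessel–Clifford series -/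

/-- The Bessel–Clifford function `∑ₙ yⁿ / (n! Γ(n + k + 1))`; one has
`j_k(x) = Γ(k + 1) besselClifford k (-x² / 4)`. -/
noncomputable def besselClifford (k y : ℝ) : ℝ :=
  ∑' n : ℕ, y ^ n / ((n ! : ℝ) * Real.Gamma ((n : ℝ) + k + 1))

lemma Gamma_shift_lower_bound {k : ℝ} (hk : -(1 / 2) ≤ k) (n : ℕ) :
    Real.Gamma (k + 1) / 2 ≤ Real.Gamma ((n : ℝ) + k + 1) := by
  have hG : 0 < Real.Gamma (k + 1) := Real.Gamma_pos_of_pos (by linarith)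
  have step : ∀ n : ℕ, Real.Gamma (((n + 1 : ℕ) : ℝ) + k + 1)
      = ((n : ℝ) + k + 1) * Real.Gamma ((n : ℝ) + k + 1) := by
    intro n
    have h0 : (0 : ℝ) ≤ n := n.cast_nonneg
    rw [← Real.Gamma_add_one (by linarith)]
    congr 1
    push_cast
    ring
  cases n with
  | zero =>
    simp only [Nat.cast_zero, zero_add]
    linarith
  | succ n =>
    induction n with
    | zero =>
      rw [step 0]
      simp only [Nat.cast_zero, zero_add]
      nlinarith
    | succ n ih =>
      rw [step (n + 1)]
      have h0 : (0 : ℝ) ≤ n := n.cast_nonneg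
      refine ih.trans (le_mul_of_one_le_left ?_ ?_)
      · linarith
      · push_cast
        linarith

lemma Gamma_shift_pos {k : ℝ} (hk : -(1 / 2) ≤ k) (n : ℕ) :
    0 < Real.Gamma ((n : ℝ) + k + 1) := by
  have h0 : (0 : ℝ) ≤ n := n.cast_nonneg
  exact Real.Gamma_pos_of_pos (by linarith)

lemma norm_besselClifford_term_le {k : ℝ} (hk : -(1 / 2) ≤ k) (n : ℕ) (y : ℝ) :
    ‖y ^ n / ((n ! : ℝ) * Real.Gamma ((n : ℝ) + k + 1))‖
      ≤ 2 / Real.Gamma (k + 1) * (|y| ^ n / (n ! : ℝ)) := by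
  have hG : 0 < Real.Gamma (k + 1) := Real.Gamma_pos_of_pos (by linarith)
  have hp := Gamma_shift_pos hk n
  have hn : (0 : ℝ) < (n ! : ℝ) := by positivity
  rw [norm_div, norm_pow, norm_mul, Real.norm_eq_abs, Real.norm_eq_abs, Real.norm_eq_abs,
    abs_of_pos hn, abs_of_pos hp]
  have h2 : 1 / Real.Gamma ((n : ℝ) + k + 1) ≤ 2 / Real.Gamma (k + 1) := by
    rw [div_le_div_iff₀ hp hG]
    linarith [Gamma_shift_lower_bound hk n]
  calc |y| ^ n / ((n ! : ℝ) * Real.Gamma ((n : ℝ) + k + 1))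
      = 1 / Real.Gamma ((n : ℝ) + k + 1) * (|y| ^ n / (n ! : ℝ)) := by field_simp
    _ ≤ _ := by gcongr

lemma summable_besselClifford {k : ℝ} (hk : -(1 / 2) ≤ k) (y : ℝ) :
    Summable fun n : ℕ => y ^ n / ((n ! : ℝ) * Real.Gamma ((n : ℝ) + k + 1)) :=
  Summable.of_norm_bounded ((Real.summable_pow_div_factorial |y|).mul_left _)
    fun n => norm_besselClifford_term_le hk n y

lemma hasDerivAt_besselClifford {k : ℝ} (hk : -(1 / 2) ≤ k) (y : ℝ) :
    HasDerivAt (besselClifford k) (besselClifford (k + 1) y) y := by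
  set R : ℝ := |y| + 1 with hR
  -- Termwise differentiation on the ball of radius `R`; the zeroth term differentiates to `0`.
  have hterm : ∀ n : ℕ, ∀ z : ℝ,
      ((n + 1 : ℕ) : ℝ) * z ^ n / (((n + 1) ! : ℕ) * Real.Gamma (((n + 1 : ℕ) : ℝ) + k + 1))
        = z ^ n / ((n ! : ℝ) * Real.Gamma ((n : ℝ) + (k + 1) + 1)) := by
    intro n z
    have h1 : Real.Gamma (((n + 1 : ℕ) : ℝ) + k + 1) = Real.Gamma ((n : ℝ) + (k + 1) + 1) := by
      congr 1
      push_cast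
      ring
    have h2 := Gamma_shift_pos (k := k + 1) (by linarith) n
    rw [h1, Nat.factorial_succ]
    push_cast
    field_simp
  have key := hasDerivAt_tsum_of_isPreconnected
    (u := fun n : ℕ => 2 / Real.Gamma (k + 1 + 1) * (R ^ n / (n ! : ℝ)))
    (g := fun (n : ℕ) (z : ℝ) => z ^ (n + 1) /
      (((n + 1) ! : ℕ) * Real.Gamma (((n + 1 : ℕ) : ℝ) + k + 1)))
    (g' := fun (n : ℕ) (z : ℝ) => z ^ n / ((n ! : ℝ) * Real.Gamma ((n : ℝ) + (k + 1) + 1)))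
    (t := Metric.ball (0 : ℝ) R) (y₀ := y) (y := y)
    ((Real.summable_pow_div_factorial R).mul_left _) Metric.isOpen_ball
    (convex_ball (0 : ℝ) R).isPreconnected ?_ ?_ (by simp [hR]) ?_ (by simp [hR])
  · have heq : besselClifford k = fun z => 1 / Real.Gamma (k + 1) + ∑' n : ℕ, z ^ (n + 1) /
        (((n + 1) ! : ℕ) * Real.Gamma (((n + 1 : ℕ) : ℝ) + k + 1)) := by
      funext z
      rw [besselClifford, (summable_besselClifford hk z).tsum_eq_zero_add]
      simp
    rw [heq]
    exact key.const_add _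
  · intro n z _
    have h := ((hasDerivAt_pow (n + 1) z).div_const
      ((((n + 1) ! : ℕ) : ℝ) * Real.Gamma (((n + 1 : ℕ) : ℝ) + k + 1)))
    simp only [Nat.add_sub_cancel] at h
    rwa [hterm n z] at h
  · intro n z hz
    refine (norm_besselClifford_term_le (k := k + 1) (by linarith) n z).trans ?_
    have hG : 0 < Real.Gamma (k + 1 + 1) := Real.Gamma_pos_of_pos (by linarith)
    have hz' : |z| ≤ R := by
      rw [Metric.mem_ball, dist_zero_right, Real.norm_eq_abs] at hz
      exact hz.le
    gcongr
  · exact (summable_nat_add_iff 1).2 (summable_besselClifford hk y)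

lemma continuous_besselClifford {k : ℝ} (hk : -(1 / 2) ≤ k) : Continuous (besselClifford k) :=
  continuous_iff_continuousAt.2 fun y => (hasDerivAt_besselClifford hk y).continuousAt

/-- The three-term recurrence, which is Bessel's differential equation in disguise. -/
lemma besselClifford_recurrence {k : ℝ} (hk : -(1 / 2) ≤ k) (y : ℝ) :
    y * besselClifford (k + 1 + 1) y + (k + 1) * besselClifford (k + 1) y
      = besselClifford k y := by
  have hs1 := summable_besselClifford (k := k + 1) (by linarith) y
  have hs2 := summable_besselClifford (k := k + 1 + 1) (by linarith) y
  have hs0 := summable_besselClifford hk y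
  have hG : ∀ n : ℕ, Real.Gamma ((n : ℝ) + (k + 1) + 1)
      = ((n : ℝ) + k + 1) * Real.Gamma ((n : ℝ) + k + 1) := by
    intro n
    have h0 : (0 : ℝ) ≤ n := n.cast_nonneg
    rw [← Real.Gamma_add_one (by linarith)]
    congr 1
    ring
  unfold besselClifford
  rw [hs0.tsum_eq_zero_add, hs1.tsum_eq_zero_add, mul_add, ← tsum_mul_left, ← tsum_mul_left,
    add_left_comm, ← Summable.tsum_add (hs2.mul_left y) (((summable_nat_add_iff 1).2 hs1).mul_left _)]
  congr 1
  · have h0 := hG 0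
    have hp := Gamma_shift_pos hk 0
    have hk1 : 0 < k + 1 := by linarith
    simp only [Nat.cast_zero, zero_add] at h0 hp ⊢
    rw [h0]
    simp
    field_simp
  · refine tsum_congr fun n => ?_
    have h0 : (0 : ℝ) ≤ n := n.cast_nonneg
    have h1 := hG (n + 1)
    have hp := Gamma_shift_pos hk (n + 1)
    have h2 : Real.Gamma ((n : ℝ) + (k + 1 + 1) + 1)
        = Real.Gamma (((n + 1 : ℕ) : ℝ) + (k + 1) + 1) := by
      congr 1
      push_cast
      ring
    rw [h2, h1, Nat.factorial_succ]
    push_cast at hp ⊢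
    have h3 : (0 : ℝ) < (n : ℝ) + 1 + k + 1 := by linarith
    field_simp
    ring

lemma normalizedBessel_eq (k x : ℝ) :
    normalizedBessel k x = Real.Gamma (k + 1) * besselClifford k (-(x ^ 2 / 4)) := by
  unfold normalizedBessel besselClifford
  congr 1
  refine tsum_congr fun n => ?_
  congr 1
  rw [pow_mul, ← mul_pow]
  congr 1
  ring

/-! ### The Dunkl kernel -/

lemma normalizedBessel_neg (k x : ℝ) : normalizedBessel k (-x) = normalizedBessel k x := by
  simp [normalizedBessel_eq]

lemma continuous_normalizedBessel {k : ℝ} (hk : -(1 / 2) ≤ k) :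
    Continuous (normalizedBessel k) := by
  have h : normalizedBessel k
      = fun x => Real.Gamma (k + 1) * besselClifford k (-(x ^ 2 / 4)) :=
    funext fun x => normalizedBessel_eq k x
  rw [h]
  exact continuous_const.mul ((continuous_besselClifford hk).comp (by fun_prop))

/-- The imaginary part `x / (2(k+1)) j_{k+1}(x)` of the Dunkl kernel. -/
noncomputable def dunklOddPart (k x : ℝ) : ℝ := x / (2 * (k + 1)) * normalizedBessel (k + 1) x

lemma dunklOddPart_neg (k x : ℝ) : dunklOddPart k (-x) = -dunklOddPart k x := by
  simp only [dunklOddPart, normalizedBessel_neg]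
  ring

lemma continuous_dunklOddPart {k : ℝ} (hk : -(1 / 2) ≤ k) : Continuous (dunklOddPart k) := by
  have := continuous_normalizedBessel (k := k + 1) (by linarith)
  unfold dunklOddPart
  fun_prop

lemma dunklKernel_eq (k ξ x : ℝ) :
    dunklKernel k ξ x = (normalizedBessel k (ξ * x) : ℂ) - Complex.I * (dunklOddPart k (ξ * x)) := by
  simp only [dunklKernel, dunklOddPart, neg_mul, normalizedBessel_neg]
  push_cast
  ring

lemma dunklOddPart_eq {k : ℝ} (hk : -(1 / 2) ≤ k) (x : ℝ) :
    dunklOddPart k x = x * (Real.Gamma (k + 1) / 2 * besselClifford (k + 1) (-(x ^ 2 / 4))) := by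
  have h : (k + 1) ≠ 0 := by linarith
  rw [dunklOddPart, normalizedBessel_eq, Real.Gamma_add_one h]
  field_simp

/-- The energy `j_k² + (x / (2(k+1)) j_{k+1})²` has derivative `-2 (2k+1) x B(x)²` for a
function `B`, so it decreases on `[0, ∞)`; its value at `0` is `1`. -/
lemma normalizedBessel_sq_add_dunklOddPart_sq_le {k : ℝ} (hk : -(1 / 2) ≤ k) (x : ℝ) :
    normalizedBessel k x ^ 2 + dunklOddPart k x ^ 2 ≤ 1 := by
  set G := Real.Gamma (k + 1) with hG
  have hGpos : 0 < G := Real.Gamma_pos_of_pos (by linarith)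
  set E : ℝ → ℝ := fun x => (G * besselClifford k (-(x ^ 2 / 4))) ^ 2
    + (x * (G / 2 * besselClifford (k + 1) (-(x ^ 2 / 4)))) ^ 2 with hE
  have hEeq : ∀ x, normalizedBessel k x ^ 2 + dunklOddPart k x ^ 2 = E x := by
    intro x
    rw [normalizedBessel_eq, dunklOddPart_eq hk]
  have hsq : ∀ x : ℝ, HasDerivAt (fun x : ℝ => -(x ^ 2 / 4)) (-(x / 2)) x := by
    intro x
    have h := ((hasDerivAt_pow 2 x).div_const 4).neg
    convert! h using 1
    push_cast
    ring
  have hd : ∀ x, HasDerivAt E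
      (-(2 * (2 * k + 1) * x * (G / 2 * besselClifford (k + 1) (-(x ^ 2 / 4))) ^ 2)) x := by
    intro x
    have h0 := (hasDerivAt_besselClifford hk (-(x ^ 2 / 4))).comp x (hsq x)
    have h1 := (hasDerivAt_besselClifford (k := k + 1) (by linarith) (-(x ^ 2 / 4))).comp x (hsq x)
    have h := ((h0.const_mul G).pow 2).add (((hasDerivAt_id x).mul (h1.const_mul (G / 2))).pow 2)
    convert! h using 1
    have hrec := besselClifford_recurrence hk (-(x ^ 2 / 4))
    simp only [Function.comp, id, Pi.mul_apply]
    rw [← hrec]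
    ring
  have hanti : AntitoneOn E (Ici 0) := by
    refine antitoneOn_of_deriv_nonpos (convex_Ici 0)
      (fun x _ => (hd x).continuousAt.continuousWithinAt)
      (fun x _ => (hd x).differentiableAt.differentiableWithinAt) fun x hx => ?_
    rw [interior_Ici, mem_Ioi] at hx
    rw [(hd x).deriv, neg_nonpos]
    have : 0 ≤ 2 * k + 1 := by linarith
    positivity
  have hE0 : E 0 = 1 := by
    have h0 : besselClifford k 0 = 1 / G := by
      rw [besselClifford, tsum_eq_single 0]
      · simp [hG]
      · intro n hn
        simp [hn]
    simp only [hE]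
    norm_num [h0, hGpos.ne']
  have hEneg : E x = E |x| := by simp [hE, mul_pow]
  rw [hEeq, hEneg, ← hE0]
  exact hanti (mem_Ici.2 le_rfl) (mem_Ici.2 (abs_nonneg x)) (abs_nonneg x)

lemma norm_dunklKernel_le_one {k : ℝ} (hk : -(1 / 2) ≤ k) (ξ x : ℝ) :
    ‖dunklKernel k ξ x‖ ≤ 1 := by
  rw [← sq_le_one_iff₀ (norm_nonneg _), dunklKernel_eq, ← Complex.normSq_eq_norm_sq,
    Complex.normSq_apply]
  have := normalizedBessel_sq_add_dunklOddPart_sq_le hk (ξ * x)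
  simp
  nlinarith

lemma continuous_dunklKernel {k : ℝ} (hk : -(1 / 2) ≤ k) :
    Continuous fun z : ℝ × ℝ => dunklKernel k z.1 z.2 := by
  have h1 := continuous_normalizedBessel hk
  have h2 := continuous_dunklOddPart hk
  simp only [dunklKernel_eq]
  fun_prop

lemma dunklKernel_comm (k ξ x : ℝ) : dunklKernel k ξ x = dunklKernel k x ξ := by
  simp only [dunklKernel_eq, mul_comm ξ x]

lemma conj_dunklKernel (k ξ x : ℝ) : conj (dunklKernel k ξ x) = dunklKernel k (-ξ) x := by
  simp [dunklKernel_eq, normalizedBessel_neg, dunklOddPart_neg]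

/-! ### The measure `μ_k` -/

/-- The density of `dunklMeasure k` with respect to Lebesgue measure. -/
noncomputable def dunklWeight (k x : ℝ) : ℝ :=
  |x| ^ (2 * k + 1) / ((2 : ℝ) ^ (k + 1) * Real.Gamma (k + 1))

lemma dunklMeasure_eq (k : ℝ) :
    dunklMeasure k = volume.withDensity fun x : ℝ => ENNReal.ofReal (dunklWeight k x) := rfl

lemma dunklNormalization_pos {k : ℝ} (hk : -(1 / 2) ≤ k) :
    0 < (2 : ℝ) ^ (k + 1) * Real.Gamma (k + 1) :=
  mul_pos (by positivity) (Real.Gamma_pos_of_pos (by linarith))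

lemma dunklWeight_nonneg {k : ℝ} (hk : -(1 / 2) ≤ k) (x : ℝ) : 0 ≤ dunklWeight k x :=
  div_nonneg (by positivity) (dunklNormalization_pos hk).le

lemma continuous_dunklWeight {k : ℝ} (hk : -(1 / 2) ≤ k) : Continuous (dunklWeight k) := by
  unfold dunklWeight
  exact (continuous_abs.rpow_const fun _ => Or.inr (by linarith)).div_const _

lemma measurable_dunklWeight (k : ℝ) : Measurable (dunklWeight k) := by
  unfold dunklWeight
  fun_prop

lemma dunklWeight_mul (k a x : ℝ) :
    dunklWeight k (a * x) = |a| ^ (2 * k + 1) * dunklWeight k x := by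
  rw [dunklWeight, dunklWeight, abs_mul, Real.mul_rpow (abs_nonneg _) (abs_nonneg _), mul_div_assoc]

instance sigmaFinite_dunklMeasure (k : ℝ) : SigmaFinite (dunklMeasure k) :=
  SigmaFinite.withDensity_ofReal _

lemma integral_dunklMeasure {E : Type*} [NormedAddCommGroup E] [NormedSpace ℝ E]
    {k : ℝ} (hk : -(1 / 2) ≤ k) (f : ℝ → E) :
    ∫ x, f x ∂(dunklMeasure k) = ∫ x, dunklWeight k x • f x := by
  rw [dunklMeasure_eq, integral_withDensity_eq_integral_toReal_smul
    (measurable_dunklWeight k).ennreal_ofReal (by simp)]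
  simp only [ENNReal.toReal_ofReal (dunklWeight_nonneg hk _)]

lemma integral_dunklMeasure_comp_abs {k : ℝ} (hk : -(1 / 2) ≤ k) (f : ℝ → ℝ) :
    ∫ x, f |x| ∂(dunklMeasure k)
      = 2 / ((2 : ℝ) ^ (k + 1) * Real.Gamma (k + 1)) * ∫ x in Ioi 0, x ^ (2 * k + 1) * f x := by
  rw [integral_dunklMeasure hk]
  have h := integral_comp_abs (f := fun r => r ^ (2 * k + 1) /
    ((2 : ℝ) ^ (k + 1) * Real.Gamma (k + 1)) * f r)
  simp only [dunklWeight, smul_eq_mul]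
  rw [h, div_mul_eq_mul_div, mul_div_assoc, ← integral_div]
  congr 1
  refine integral_congr_ae (ae_of_all _ fun x => ?_)
  simp only
  ring

lemma map_mul_left_dunklMeasure (k : ℝ) {a : ℝ} (ha : a ≠ 0) :
    (dunklMeasure k).map (fun x => a * x)
      = ENNReal.ofReal (|a| ^ (-(2 * k + 2))) • dunklMeasure k := by
  refine Measure.ext_of_lintegral _ fun F hF => ?_
  have hw : Measurable fun x => ENNReal.ofReal (dunklWeight k x) :=
    (measurable_dunklWeight k).ennreal_ofReal
  have ha' : 0 < |a| := abs_pos.2 ha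
  have hFa : Measurable fun x => F (a * x) := hF.comp (measurable_const_mul a)
  rw [lintegral_map hF (measurable_const_mul a), lintegral_smul_measure, dunklMeasure_eq,
    lintegral_withDensity_eq_lintegral_mul _ hw hFa, lintegral_withDensity_eq_lintegral_mul _ hw hF]
  simp only [Pi.mul_apply]
  have h1 : ∀ x, ENNReal.ofReal (dunklWeight k x) * F (a * x)
      = ENNReal.ofReal (|a| ^ (-(2 * k + 1))) *
        (ENNReal.ofReal (dunklWeight k (a * x)) * F (a * x)) := by
    intro x
    rw [← mul_assoc, ← ENNReal.ofReal_mul (by positivity), dunklWeight_mul, ← mul_assoc,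
      ← Real.rpow_add ha']
    simp
  have hprod : Measurable fun y => ENNReal.ofReal (dunklWeight k y) * F y := hw.mul hF
  simp only [h1]
  have hmap := lintegral_map (μ := volume) hprod (measurable_const_mul a)
  rw [lintegral_const_mul' _ _ ENNReal.ofReal_ne_top, ← hmap, Real.map_volume_mul_left ha,
    lintegral_smul_measure, smul_eq_mul, smul_eq_mul, ← mul_assoc,
    ← ENNReal.ofReal_mul (by positivity), abs_inv, ← Real.rpow_neg_one, ← Real.rpow_add ha']
  congr 3
  ring

instance isNegInvariant_dunklMeasure (k : ℝ) : (dunklMeasure k).IsNegInvariant := by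
  refine ⟨?_⟩
  have h := map_mul_left_dunklMeasure k (a := -1) (by norm_num)
  simp only [abs_neg, abs_one, Real.one_rpow, ENNReal.ofReal_one, one_smul, neg_one_mul] at h
  exact h

lemma dunklMeasure_Icc {k : ℝ} (hk : -(1 / 2) ≤ k) {r : ℝ} (hr : 0 < r) :
    dunklMeasure k (Icc (-r) r)
      = ENNReal.ofReal (r ^ (2 * k + 2) / ((2 : ℝ) ^ (k + 1) * Real.Gamma (k + 2))) := by
  have hc := dunklNormalization_pos hk
  have hint : IntegrableOn (dunklWeight k) (Icc (-r) r) :=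
    (continuous_dunklWeight hk).continuousOn.integrableOn_Icc
  rw [dunklMeasure_eq, withDensity_apply _ measurableSet_Icc,
    ← ofReal_integral_eq_lintegral_ofReal hint (ae_of_all _ (dunklWeight_nonneg hk))]
  congr 1
  have h := integral_dunklMeasure_comp_abs hk ((Iic r).indicator 1)
  have hset : ∀ x : ℝ, dunklWeight k x • (Iic r).indicator (1 : ℝ → ℝ) |x|
      = (Icc (-r) r).indicator (dunklWeight k) x := by
    intro x
    by_cases hx : |x| ≤ r
    · rw [indicator_of_mem (by exact hx), indicator_of_mem (by exact abs_le.1 hx)]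
      simp
    · rw [indicator_of_notMem (by exact hx),
        indicator_of_notMem (by rw [mem_Icc, ← abs_le]; exact hx)]
      simp
  rw [integral_dunklMeasure hk] at h
  simp only [hset] at h
  rw [integral_indicator measurableSet_Icc] at h
  have hset2 : ∀ x : ℝ, x ^ (2 * k + 1) * (Iic r).indicator (1 : ℝ → ℝ) x
      = (Iic r).indicator (fun x : ℝ => x ^ (2 * k + 1)) x := by
    intro x
    by_cases hx : x ∈ Iic r <;> simp [hx]
  simp only [hset2] at h
  rw [setIntegral_indicator measurableSet_Iic, Ioi_inter_Iic,
    ← intervalIntegral.integral_of_le hr.le, integral_rpow (Or.inl (by linarith)),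
    Real.zero_rpow (by linarith)] at h
  rw [h, show k + 2 = k + 1 + 1 by ring, Real.Gamma_add_one (s := k + 1) (by linarith),
    show 2 * k + 1 + 1 = 2 * k + 2 by ring]
  have h1 : (0 : ℝ) < 2 * k + 2 := by linarith
  have h2 : (0 : ℝ) < k + 1 := by linarith
  have h3 := Real.Gamma_pos_of_pos h2
  field_simp
  ring

/-! ### Gaussian moments and the Dunkl transform of Gaussians -/

lemma integral_abs_pow_mul_gaussian {k : ℝ} (hk : -(1 / 2) ≤ k) (m : ℕ) {t : ℝ} (ht : 0 < t) :
    ∫ x, |x| ^ m * Real.exp (-t * x ^ 2) ∂(dunklMeasure k)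
      = t ^ (-((m : ℝ) / 2 + k + 1)) * Real.Gamma ((m : ℝ) / 2 + k + 1) /
        ((2 : ℝ) ^ (k + 1) * Real.Gamma (k + 1)) := by
  have h := integral_dunklMeasure_comp_abs hk (fun r => r ^ m * Real.exp (-t * r ^ 2))
  simp only [sq_abs] at h
  have h0 : (0 : ℝ) ≤ m := m.cast_nonneg
  have h1 : ∫ x in Ioi (0 : ℝ), x ^ (2 * k + 1) * (x ^ m * Real.exp (-t * x ^ 2))
      = ∫ x in Ioi (0 : ℝ), x ^ (2 * k + 1 + m) * Real.exp (-t * x ^ (2 : ℝ)) := by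
    refine setIntegral_congr_fun measurableSet_Ioi fun x hx => ?_
    rw [Real.rpow_add hx (2 * k + 1), Real.rpow_natCast, Real.rpow_two, mul_assoc]
  rw [h, h1, integral_rpow_mul_exp_neg_mul_rpow (by norm_num) (by linarith) ht,
    show (2 * k + 1 + m + 1) / 2 = (m : ℝ) / 2 + k + 1 by ring,
    show -(2 * k + 1 + m + 1) / 2 = -((m : ℝ) / 2 + k + 1) by ring]
  ring

lemma integrable_abs_pow_mul_gaussian {k : ℝ} (hk : -(1 / 2) ≤ k) (m : ℕ) {t : ℝ} (ht : 0 < t) :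
    Integrable (fun x => |x| ^ m * Real.exp (-t * x ^ 2)) (dunklMeasure k) := by
  -- A nonintegrable function would have integral `0`.
  refine Integrable.of_integral_ne_zero ?_
  rw [integral_abs_pow_mul_gaussian hk m ht]
  have h0 : (0 : ℝ) ≤ m := m.cast_nonneg
  have h1 : 0 < Real.Gamma ((m : ℝ) / 2 + k + 1) := Real.Gamma_pos_of_pos (by linarith)
  have h2 := dunklNormalization_pos hk
  positivity

lemma integrable_pow_mul_gaussian {k : ℝ} (hk : -(1 / 2) ≤ k) (m : ℕ) {t : ℝ} (ht : 0 < t) :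
    Integrable (fun x => x ^ m * Real.exp (-t * x ^ 2)) (dunklMeasure k) := by
  refine (integrable_abs_pow_mul_gaussian hk m ht).mono (by fun_prop) (ae_of_all _ fun x => ?_)
  simp

/-- Weber's first exponential integral, by termwise integration of the series of `j_k`. -/
lemma integral_normalizedBessel_mul_gaussian {k : ℝ} (hk : -(1 / 2) ≤ k) {t : ℝ} (ht : 0 < t)
    (ξ : ℝ) :
    ∫ x, normalizedBessel k (ξ * x) * Real.exp (-t * x ^ 2) ∂(dunklMeasure k)
      = (2 * t) ^ (-(k + 1)) * Real.exp (-(1 / (4 * t)) * ξ ^ 2) := by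
  have hG : 0 < Real.Gamma (k + 1) := Real.Gamma_pos_of_pos (by linarith)
  set c : ℕ → ℝ := fun n => Real.Gamma (k + 1) * (-(ξ ^ 2 / 4)) ^ n /
    ((n ! : ℝ) * Real.Gamma ((n : ℝ) + k + 1)) with hcdef
  set F : ℕ → ℝ → ℝ := fun n x => c n * (|x| ^ (2 * n) * Real.exp (-t * x ^ 2)) with hF
  have hmom : ∀ n : ℕ, ∫ x, |x| ^ (2 * n) * Real.exp (-t * x ^ 2) ∂(dunklMeasure k)
      = t ^ (-(n + k + 1)) * Real.Gamma ((n : ℝ) + k + 1) /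
        ((2 : ℝ) ^ (k + 1) * Real.Gamma (k + 1)) := by
    intro n
    rw [integral_abs_pow_mul_gaussian hk (2 * n) ht]
    push_cast
    rw [mul_div_cancel_left₀ _ (two_ne_zero)]
  have hval : ∀ n : ℕ, ∀ d : ℝ, Real.Gamma (k + 1) * d ^ n /
      ((n ! : ℝ) * Real.Gamma ((n : ℝ) + k + 1)) * (t ^ (-(n + k + 1)) *
        Real.Gamma ((n : ℝ) + k + 1) / ((2 : ℝ) ^ (k + 1) * Real.Gamma (k + 1)))
      = (2 * t) ^ (-(k + 1)) * ((d / t) ^ n / (n ! : ℝ)) := by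
    intro n d
    have hp := Gamma_shift_pos hk n
    rw [Real.mul_rpow (by norm_num) ht.le, Real.rpow_neg (by norm_num : (0 : ℝ) ≤ 2),
      show -((n : ℝ) + k + 1) = -(k + 1) + -(n : ℝ) by ring, Real.rpow_add ht,
      Real.rpow_neg ht.le (n : ℝ), Real.rpow_natCast, div_pow]
    have h2 : (0 : ℝ) < 2 ^ (k + 1) := by positivity
    field_simp
  have hsum : ∀ x, ∑' n, F n x = normalizedBessel k (ξ * x) * Real.exp (-t * x ^ 2) := by
    intro x
    rw [normalizedBessel_eq, besselClifford, mul_assoc, ← tsum_mul_right, ← tsum_mul_left]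
    refine tsum_congr fun n => ?_
    simp only [hF, hcdef]
    rw [pow_mul, sq_abs, show -((ξ * x) ^ 2 / 4) = -(ξ ^ 2 / 4) * x ^ 2 by ring, mul_pow]
    ring
  have hnorm : ∀ n, ∫ x, ‖F n x‖ ∂(dunklMeasure k)
      = (2 * t) ^ (-(k + 1)) * (((ξ ^ 2 / 4) / t) ^ n / (n ! : ℝ)) := by
    intro n
    have hp := Gamma_shift_pos hk n
    rw [← hval n (ξ ^ 2 / 4), ← hmom n, ← integral_const_mul]
    refine integral_congr_ae (ae_of_all _ fun x => ?_)
    simp only [hF, hcdef]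
    rw [norm_mul, Real.norm_eq_abs, Real.norm_eq_abs,
      abs_of_nonneg (by positivity : 0 ≤ |x| ^ (2 * n) * Real.exp (-t * x ^ 2)), abs_div, abs_mul,
      abs_pow, abs_neg, abs_of_pos hG, abs_of_nonneg (by positivity : 0 ≤ ξ ^ 2 / 4),
      abs_of_nonneg (by positivity : 0 ≤ (n ! : ℝ) * Real.Gamma ((n : ℝ) + k + 1))]
  have key := hasSum_integral_of_summable_integral_norm (μ := dunklMeasure k) (F := F)
    (fun n => (integrable_abs_pow_mul_gaussian hk (2 * n) ht).const_mul _)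
    (by
      simp only [hnorm]
      exact (Real.summable_pow_div_factorial _).mul_left _)
  simp only [hsum] at key
  have hint : ∀ n, ∫ x, F n x ∂(dunklMeasure k)
      = (2 * t) ^ (-(k + 1)) * ((-(ξ ^ 2 / 4) / t) ^ n / (n ! : ℝ)) := by
    intro n
    rw [← hval n (-(ξ ^ 2 / 4)), ← hmom n, ← integral_const_mul]
  simp only [hint] at key
  have hexp := (NormedSpace.expSeries_div_hasSum_exp (-(ξ ^ 2 / 4) / t)).mul_left
    ((2 * t) ^ (-(k + 1)))
  rw [key.unique hexp, ← Real.exp_eq_exp_ℝ]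
  congr 2
  field_simp

/-! ### Moments of a bounded function determine a density -/

section Moments

variable {X : Type*} [MeasurableSpace X] {ν : Measure X}

/-- If all moments `∫ h wⁿ` of a bounded function `w` vanish, so do the exponential moments
`∫ h exp(iτw)`, by expanding the exponential. -/
lemma integral_mul_cexp_eq_zero_of_moments {h w : X → ℝ} (hh : Integrable h ν)
    (hw : Measurable w) (hw1 : ∀ x, |w x| ≤ 1) (hmom : ∀ n : ℕ, ∫ x, h x * w x ^ n ∂ν = 0)
    (τ : ℝ) : ∫ x, (h x : ℂ) * Complex.exp (τ * w x * Complex.I) ∂ν = 0 := by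
  have hint : ∀ n : ℕ, Integrable (fun x => h x * w x ^ n) ν := fun n =>
    hh.mul_bdd (c := 1) (hw.pow_const n).aestronglyMeasurable
      (ae_of_all _ fun x => by
        rw [norm_pow, Real.norm_eq_abs]
        exact pow_le_one₀ (abs_nonneg _) (hw1 x))
  set F : ℕ → X → ℂ := fun n x => (τ * Complex.I) ^ n / (n ! : ℂ) * ((h x * w x ^ n : ℝ) : ℂ)
    with hF
  have hFint : ∀ n, Integrable (F n) ν := fun n => (hint n).ofReal.const_mul _
  have key := hasSum_integral_of_summable_integral_norm (F := F) hFint ?_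
  · have hs : ∀ x, ∑' n, F n x = (h x : ℂ) * Complex.exp (τ * w x * Complex.I) := by
      intro x
      rw [Complex.exp_eq_exp_ℂ, NormedSpace.exp_eq_tsum_div, ← tsum_mul_left]
      refine tsum_congr fun n => ?_
      simp only [hF]
      push_cast
      ring
    simp only [hs] at key
    have h0 : ∀ n, ∫ x, F n x ∂ν = 0 := by
      intro n
      simp only [hF]
      rw [integral_const_mul, integral_complex_ofReal, hmom n]
      simp
    simp only [h0] at key
    exact key.unique hasSum_zero
  · refine Summable.of_nonneg_of_le (fun n => integral_nonneg fun x => norm_nonneg _) (fun n => ?_)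
      ((Real.summable_pow_div_factorial |τ|).mul_right (∫ x, ‖h x‖ ∂ν))
    rw [← integral_const_mul]
    refine integral_mono (hFint n).norm (hh.norm.const_mul _) fun x => ?_
    simp only [hF, norm_mul, norm_div, norm_pow, Complex.norm_real, Complex.norm_I, mul_one,
      Complex.norm_natCast, Real.norm_eq_abs]
    gcongr
    exact mul_le_of_le_one_right (abs_nonneg _) (pow_le_one₀ (abs_nonneg _) (hw1 x))

/-- If all moments `∫ h wⁿ` of a bounded function `w` vanish, then `h` is orthogonal to every
bounded measurable function of `w`: the positive and the negative part of `h` push forward under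
`w` to finite measures with the same characteristic function. -/
lemma integral_mul_comp_eq_zero_of_moments {h w : X → ℝ} (hh : Integrable h ν)
    (hw : Measurable w) (hw1 : ∀ x, |w x| ≤ 1) (hmom : ∀ n : ℕ, ∫ x, h x * w x ^ n ∂ν = 0)
    {G : ℝ → ℝ} (hG : Measurable G) {C : ℝ} (hGC : ∀ y, |G y| ≤ C) :
    ∫ x, h x * G (w x) ∂ν = 0 := by
  set P : (X → ℝ) → Measure ℝ := fun h => (ν.withDensity fun x => ENNReal.ofReal (h x)).map w
    with hP
  have hPint : ∀ {E : Type} [NormedAddCommGroup E] [NormedSpace ℝ E] (h : X → ℝ),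
      Integrable h ν → ∀ g : ℝ → E, StronglyMeasurable g →
      ∫ y, g y ∂(P h) = ∫ x, max (h x) 0 • g (w x) ∂ν := by
    intro E _ _ h hh g hg
    simp only [hP]
    rw [integral_map hw.aemeasurable hg.aestronglyMeasurable,
      integral_withDensity_eq_integral_toReal_smul₀ hh.1.aemeasurable.ennreal_ofReal (by simp)]
    simp only [ENNReal.toReal_ofReal']
  have hPfin : ∀ h : X → ℝ, Integrable h ν → IsFiniteMeasure (P h) := by
    intro h hh
    have := isFiniteMeasure_withDensity_ofReal hh.2
    exact Measure.isFiniteMeasure_map _ _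
  have hsplit : ∀ r : ℝ, max r 0 - max (-r) 0 = r := by
    intro r
    rcases le_total r 0 with hr | hr
    · rw [max_eq_right hr, max_eq_left (by linarith)]
      ring
    · rw [max_eq_left hr, max_eq_right (by linarith)]
      ring
  have hpos : Integrable (fun x => max (h x) 0) ν := hh.pos_part
  have hneg : Integrable (fun x => max (-h x) 0) ν := hh.neg_part
  have hbdd : ∀ {E : Type} [NormedAddCommGroup E] [NormedSpace ℝ E] (r : X → ℝ) (g : X → E) (C : ℝ),
      Integrable r ν → AEStronglyMeasurable g ν → (∀ᵐ x ∂ν, ‖g x‖ ≤ C) →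
      Integrable (fun x => r x • g x) ν := by
    intro E _ _ r g C hr hg hC
    have : Integrable (r • g) ν := hr.smul_bdd C hg hC
    exact this
  have hh' : Integrable (fun x => -h x) ν := hh.neg
  have hPP : P h = P (fun x => -h x) := by
    have := hPfin h hh
    have := hPfin _ hh'
    refine Measure.ext_of_charFun (funext fun τ => ?_)
    have hm : StronglyMeasurable fun y : ℝ => Complex.exp (τ * y * Complex.I) :=
      Continuous.stronglyMeasurable (by fun_prop)
    rw [charFun_apply_real, charFun_apply_real, hPint h hh _ hm, hPint _ hh' _ hm, ← sub_eq_zero,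
      ← integral_sub, ← integral_mul_cexp_eq_zero_of_moments hh hw hw1 hmom τ]
    · refine integral_congr_ae (ae_of_all _ fun x => ?_)
      simp only
      rw [← sub_smul, hsplit, Complex.real_smul]
    all_goals
      refine hbdd _ _ 1 (by assumption) (hm.comp_measurable hw).aestronglyMeasurable
        (ae_of_all _ fun x => ?_)
      have := Complex.norm_exp_ofReal_mul_I (τ * w x)
      push_cast at this
      exact this.le
  have h1 := hPint h hh G hG.stronglyMeasurable
  rw [hPP, hPint _ hh' G hG.stronglyMeasurable] at h1
  have hb : ∀ᵐ x ∂ν, ‖G (w x)‖ ≤ C := ae_of_all _ fun x => hGC _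
  have hGm : AEStronglyMeasurable (fun x => G (w x)) ν := (hG.comp hw).aestronglyMeasurable
  have h2 : ∫ x, (max (h x) 0 • G (w x) - max (-h x) 0 • G (w x)) ∂ν = 0 := by
    rw [integral_sub (hbdd _ _ C hpos hGm hb) (hbdd _ _ C hneg hGm hb), h1, sub_self]
  rw [← h2]
  refine integral_congr_ae (ae_of_all _ fun x => ?_)
  simp only
  rw [← sub_smul, hsplit, smul_eq_mul]

end Moments

/-- Real case of `ae_eq_zero_of_even_of_gaussian_moments`: every even function on the line is a
function of `exp(-x²)`. -/
lemma ae_eq_zero_of_even_of_gaussian_moments_real {μ : Measure ℝ} [μ.IsNegInvariant] {h : ℝ → ℝ}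
    (hh : Integrable h μ) (heven : ∀ x, h (-x) = h x)
    (hmom : ∀ n : ℕ, ∫ x, h x * Real.exp (-x ^ 2) ^ n ∂μ = 0) : h =ᵐ[μ] 0 := by
  refine hh.ae_eq_zero_of_forall_setIntegral_eq_zero fun S hS _ => ?_
  set χ : ℝ → ℝ := S.indicator 1 with hχ
  have hχm : Measurable χ := measurable_one.indicator hS
  have hχ1 : ∀ x, |χ x| ≤ 1 := by
    intro x
    by_cases hx : x ∈ S <;> simp [hχ, hx]
  have key := integral_mul_comp_eq_zero_of_moments hh (w := fun x => Real.exp (-x ^ 2))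
    (by fun_prop) (fun x => by
      rw [abs_of_pos (Real.exp_pos _), Real.exp_le_one_iff]
      nlinarith [sq_nonneg x]) hmom
    (G := fun y => χ √(-Real.log y) + χ (-√(-Real.log y))) (C := 2) (by fun_prop)
    (fun y => (abs_add_le _ _).trans (by linarith [hχ1 √(-Real.log y), hχ1 (-√(-Real.log y))]))
  have hval : ∀ x : ℝ, χ √(-Real.log (Real.exp (-x ^ 2))) + χ (-√(-Real.log (Real.exp (-x ^ 2))))
      = χ x + χ (-x) := by
    intro x
    rw [Real.log_exp, neg_neg, Real.sqrt_sq_eq_abs]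
    rcases abs_choice x with hx | hx <;> rw [hx]
    rw [neg_neg, add_comm]
  simp only [hval, mul_add] at key
  have hi : Integrable (fun x => h x * χ x) μ :=
    hh.mul_bdd (c := 1) hχm.aestronglyMeasurable (ae_of_all _ hχ1)
  have hi' : Integrable (fun x => h x * χ (-x)) μ := by
    have := hi.comp_neg
    simpa only [heven] using this
  rw [integral_add hi hi'] at key
  have hrefl : ∫ x, h x * χ (-x) ∂μ = ∫ x, h x * χ x ∂μ := by
    have := integral_neg_eq_self (fun x => h x * χ x) μ
    simpa only [heven] using this
  rw [hrefl] at key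
  rw [← integral_indicator hS]
  have hind : ∀ x, S.indicator h x = h x * χ x := by
    intro x
    by_cases hx : x ∈ S <;> simp [hχ, hx]
  simp only [hind]
  linarith

lemma ae_eq_zero_of_even_of_gaussian_moments {μ : Measure ℝ} [μ.IsNegInvariant] {h : ℝ → ℂ}
    (hh : Integrable h μ) (heven : ∀ x, h (-x) = h x)
    (hmom : ∀ n : ℕ, ∫ x, h x * (Real.exp (-x ^ 2) : ℂ) ^ n ∂μ = 0) : h =ᵐ[μ] 0 := by
  have hint : ∀ n : ℕ, Integrable (fun x => h x * (Real.exp (-x ^ 2) : ℂ) ^ n) μ := fun n =>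
    hh.mul_bdd (c := 1) (Continuous.aestronglyMeasurable (by fun_prop)) (ae_of_all _ fun x => by
        rw [norm_pow, Complex.norm_real, Real.norm_eq_abs, abs_of_pos (Real.exp_pos _)]
        refine pow_le_one₀ (Real.exp_pos _).le ?_
        rw [Real.exp_le_one_iff]
        nlinarith [sq_nonneg x])
  have hre := ae_eq_zero_of_even_of_gaussian_moments_real (h := fun x => (h x).re) hh.re
    (fun x => by rw [heven]) fun n => by
      have := Complex.reCLM.integral_comp_comm (hint n)
      rw [hmom n] at this
      rw [← Complex.zero_re, ← Complex.reCLM_apply, ← this]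
      refine integral_congr_ae (ae_of_all _ fun x => ?_)
      simp only [Complex.reCLM_apply, ← Complex.ofReal_pow, Complex.re_mul_ofReal]
  have him := ae_eq_zero_of_even_of_gaussian_moments_real (h := fun x => (h x).im) hh.im
    (fun x => by rw [heven]) fun n => by
      have := Complex.imCLM.integral_comp_comm (hint n)
      rw [hmom n] at this
      rw [← Complex.zero_im, ← Complex.imCLM_apply, ← this]
      refine integral_congr_ae (ae_of_all _ fun x => ?_)
      simp only [Complex.imCLM_apply, ← Complex.ofReal_pow, Complex.im_mul_ofReal]
  filter_upwards [hre, him] with x h1 h2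
  exact Complex.ext h1 h2

/-! ### Convergence in `L^p` -/

section Lp

variable {X : Type*} [MeasurableSpace X] {μ : Measure X}

/-- If `v` maps differences into `L^q` at most `C` times as large as the differences of `u` in
`L^p`, and `u` converges in `L^p`, then `v` converges in `L^q`. -/
lemma exists_tendsto_eLpNorm_of_le {p q : ℝ≥0∞} (hp : 1 ≤ p) (hq : 1 ≤ q) {u v : ℕ → X → ℂ}
    {f : X → ℂ} {C : ℝ≥0∞} (hC : C ≠ ∞) (hu : ∀ n, MemLp (u n) p μ) (hf : MemLp f p μ)
    (hv : ∀ n, MemLp (v n) q μ)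
    (hle : ∀ n m, eLpNorm (v n - v m) q μ ≤ C * eLpNorm (u n - u m) p μ)
    (hlim : Tendsto (fun n => eLpNorm (u n - f) p μ) atTop (𝓝 0)) :
    ∃ g, MemLp g q μ ∧ Tendsto (fun n => eLpNorm (v n - g) q μ) atTop (𝓝 0) := by
  have : Fact (1 ≤ q) := ⟨hq⟩
  have : Fact (1 ≤ p) := ⟨hp⟩
  have hcau : CauchySeq fun n => (hv n).toLp (v n) := by
    rw [EMetric.cauchySeq_iff]
    intro ε hε
    have hlim' : Tendsto (fun n => C * eLpNorm (u n - f) p μ) atTop (𝓝 0) := by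
      simpa using ENNReal.Tendsto.const_mul hlim (Or.inr hC)
    obtain ⟨N, hN⟩ := eventually_atTop.1
      (hlim'.eventually (gt_mem_nhds (ENNReal.half_pos hε.ne')))
    refine ⟨N, fun m hm n hn => ?_⟩
    rw [Lp.edist_toLp_toLp]
    calc eLpNorm (v m - v n) q μ ≤ C * eLpNorm (u m - u n) p μ := hle m n
      _ = C * eLpNorm ((u m - f) - (u n - f)) p μ := by rw [sub_sub_sub_cancel_right]
      _ ≤ C * (eLpNorm (u m - f) p μ + eLpNorm (u n - f) p μ) := by
        gcongr
        exact eLpNorm_sub_le ((hu m).sub hf).1 ((hu n).sub hf).1 hp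
      _ = C * eLpNorm (u m - f) p μ + C * eLpNorm (u n - f) p μ := mul_add _ _ _
      _ < ε / 2 + ε / 2 := ENNReal.add_lt_add (hN m hm) (hN n hn)
      _ = ε := ENNReal.add_halves ε
  obtain ⟨g, hg⟩ := cauchySeq_tendsto_of_complete hcau
  refine ⟨g, Lp.memLp g, ?_⟩
  rw [Lp.tendsto_Lp_iff_tendsto_eLpNorm'] at hg
  refine hg.congr fun n => eLpNorm_congr_ae ?_
  filter_upwards [(hv n).coeFn_toLp] with x hx
  simp [hx]

lemma integral_mul_enorm_le {p q : ℝ≥0∞} [hpq : p.HolderConjugate q] {u a : X → ℂ}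
    (hu : AEStronglyMeasurable u μ) (ha : AEStronglyMeasurable a μ) :
    ‖∫ x, u x * a x ∂μ‖ₑ ≤ eLpNorm u p μ * eLpNorm a q μ := by
  refine (enorm_integral_le_lintegral_enorm _).trans ?_
  rw [← eLpNorm_one_eq_lintegral_enorm]
  have h : (fun x => u x * a x) = u • a := funext fun x => (smul_eq_mul (u x) (a x)).symm
  rw [h]
  exact eLpNorm_smul_le_mul_eLpNorm ha hu

lemma MeasureTheory.MemLp.integrable_mul_of_holderConjugate {p q : ℝ≥0∞}
    [hpq : p.HolderConjugate q] {u a : X → ℂ}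
    (hu : MemLp u p μ) (ha : MemLp a q μ) : Integrable (fun x => u x * a x) μ :=
  memLp_one_iff_integrable.1 (ha.mul hu)

lemma tendsto_integral_mul_of_tendsto_eLpNorm {p q : ℝ≥0∞} [hpq : p.HolderConjugate q]
    {u : ℕ → X → ℂ} {f a : X → ℂ} (hu : ∀ n, MemLp (u n) p μ) (hf : MemLp f p μ)
    (ha : MemLp a q μ) (hlim : Tendsto (fun n => eLpNorm (u n - f) p μ) atTop (𝓝 0)) :
    Tendsto (fun n => ∫ x, u n x * a x ∂μ) atTop (𝓝 (∫ x, f x * a x ∂μ)) := by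
  rw [tendsto_iff_edist_tendsto_0]
  have hlim' : Tendsto (fun n => eLpNorm (u n - f) p μ * eLpNorm a q μ) atTop (𝓝 0) := by
    simpa using ENNReal.Tendsto.mul_const hlim (Or.inr ha.2.ne)
  refine tendsto_of_tendsto_of_tendsto_of_le_of_le tendsto_const_nhds hlim' (fun _ => zero_le)
    fun n => ?_
  have := integral_mul_enorm_le (p := p) (q := q) ((hu n).sub hf).1 ha.1
  refine le_trans (le_of_eq ?_) this
  rw [edist_eq_enorm_sub, ← integral_sub ((hu n).integrable_mul_of_holderConjugate ha)
    (hf.integrable_mul_of_holderConjugate ha)]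
  congr 1
  refine integral_congr_ae (ae_of_all _ fun x => ?_)
  simp [sub_mul]

end Lp

/-! ### The Dunkl transform on `L¹` -/

/-- The Dunkl transform `∫ f(x) E_k(-iξ, x) dμ_k(x)` of a `μ_k`-integrable function. -/
noncomputable def dunklTransform (k : ℝ) (f : ℝ → ℂ) (ξ : ℝ) : ℂ :=
  ∫ x, f x * dunklKernel k ξ x ∂(dunklMeasure k)

section Transform

variable {k : ℝ}

lemma continuous_dunklKernel_right (hk : -(1 / 2) ≤ k) (ξ : ℝ) : Continuous (dunklKernel k ξ) :=
  (continuous_dunklKernel hk).comp (continuous_const.prodMk continuous_id)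

lemma integrable_mul_dunklKernel (hk : -(1 / 2) ≤ k) {f : ℝ → ℂ}
    (hf : Integrable f (dunklMeasure k)) (ξ : ℝ) :
    Integrable (fun x => f x * dunklKernel k ξ x) (dunklMeasure k) :=
  hf.mul_bdd (c := 1) (continuous_dunklKernel_right hk ξ).aestronglyMeasurable
    (ae_of_all _ fun x => norm_dunklKernel_le_one hk ξ x)

lemma norm_dunklTransform_le (hk : -(1 / 2) ≤ k) {f : ℝ → ℂ}
    (hf : Integrable f (dunklMeasure k)) (ξ : ℝ) :
    ‖dunklTransform k f ξ‖ ≤ ∫ x, ‖f x‖ ∂(dunklMeasure k) := by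
  refine norm_integral_le_of_norm_le hf.norm (ae_of_all _ fun x => ?_)
  rw [norm_mul]
  exact mul_le_of_le_one_right (norm_nonneg _) (norm_dunklKernel_le_one hk ξ x)

lemma continuous_dunklTransform (hk : -(1 / 2) ≤ k) {f : ℝ → ℂ}
    (hf : Integrable f (dunklMeasure k)) : Continuous (dunklTransform k f) := by
  refine continuous_of_dominated (bound := fun x => ‖f x‖)
    (fun ξ => (integrable_mul_dunklKernel hk hf ξ).1) (fun ξ => ae_of_all _ fun x => ?_) hf.norm
    (ae_of_all _ fun x => ?_)
  · rw [norm_mul]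
    exact mul_le_of_le_one_right (norm_nonneg _) (norm_dunklKernel_le_one hk ξ x)
  · exact continuous_const.mul
      ((continuous_dunklKernel hk).comp (continuous_id.prodMk continuous_const))

lemma dunklTransform_add (hk : -(1 / 2) ≤ k) {f g : ℝ → ℂ}
    (hf : Integrable f (dunklMeasure k)) (hg : Integrable g (dunklMeasure k)) :
    dunklTransform k (f + g) = dunklTransform k f + dunklTransform k g := by
  funext ξ
  simp only [dunklTransform, Pi.add_apply, add_mul]
  exact integral_add (integrable_mul_dunklKernel hk hf ξ) (integrable_mul_dunklKernel hk hg ξ)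

lemma dunklTransform_smul (c : ℂ) (f : ℝ → ℂ) :
    dunklTransform k (c • f) = c • dunklTransform k f := by
  funext ξ
  simp only [dunklTransform, Pi.smul_apply, smul_eq_mul, mul_assoc]
  exact integral_const_mul _ _

lemma dunklTransform_zero : dunklTransform k 0 = 0 := by
  funext ξ
  simp [dunklTransform]

lemma dunklTransform_conj (f : ℝ → ℂ) (ξ : ℝ) :
    dunklTransform k (fun x => conj (f x)) ξ = conj (dunklTransform k f (-ξ)) := by
  rw [dunklTransform, dunklTransform, ← integral_conj]
  simp only [map_mul, conj_dunklKernel, neg_neg]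

/-- The kernel is symmetric, so the transform moves across the pairing `∫ f g dμ_k`. -/
lemma integral_dunklTransform_mul (hk : -(1 / 2) ≤ k) {f g : ℝ → ℂ}
    (hf : Integrable f (dunklMeasure k)) (hg : Integrable g (dunklMeasure k)) :
    ∫ ξ, dunklTransform k f ξ * g ξ ∂(dunklMeasure k)
      = ∫ x, f x * dunklTransform k g x ∂(dunklMeasure k) := by
  have hint : Integrable (fun z : ℝ × ℝ => f z.2 * dunklKernel k z.1 z.2 * g z.1)
      ((dunklMeasure k).prod (dunklMeasure k)) := by
    have h := (hg.mul_prod hf).mul_bdd (c := 1) (continuous_dunklKernel hk).aestronglyMeasurable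
      (ae_of_all _ fun z => norm_dunklKernel_le_one hk z.1 z.2)
    refine h.congr (ae_of_all _ fun z => ?_)
    simp only
    ring
  have hswap := integral_integral_swap (f := fun ξ x => f x * dunklKernel k ξ x * g ξ) hint
  simp only [dunklTransform]
  simp only [← integral_mul_const, ← integral_const_mul]
  rw [hswap]
  refine integral_congr_ae (ae_of_all _ fun x => ?_)
  simp only
  refine integral_congr_ae (ae_of_all _ fun ξ => ?_)
  simp only
  rw [dunklKernel_comm]
  ring

/-! ### Gaussians -/

/-- The functions `x ↦ x^m exp(-t x²)`; only `m = 0` and `m = 1` are used. -/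
noncomputable def gaussianAtom (m : ℕ) (t x : ℝ) : ℂ := ((x ^ m * Real.exp (-t * x ^ 2) : ℝ) : ℂ)

lemma continuous_gaussianAtom (m : ℕ) (t : ℝ) : Continuous (gaussianAtom m t) := by
  unfold gaussianAtom
  fun_prop

lemma integrable_gaussianAtom (hk : -(1 / 2) ≤ k) (m : ℕ) {t : ℝ} (ht : 0 < t) :
    Integrable (gaussianAtom m t) (dunklMeasure k) :=
  (integrable_pow_mul_gaussian hk m ht).ofReal

lemma memLp_two_gaussianAtom (hk : -(1 / 2) ≤ k) (m : ℕ) {t : ℝ} (ht : 0 < t) :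
    MemLp (gaussianAtom m t) 2 (dunklMeasure k) := by
  rw [memLp_two_iff_integrable_sq_norm (continuous_gaussianAtom m t).aestronglyMeasurable]
  refine (integrable_pow_mul_gaussian hk (2 * m) (t := 2 * t) (by positivity)).congr
    (ae_of_all _ fun x => ?_)
  simp only [gaussianAtom]
  rw [Complex.norm_real, Real.norm_eq_abs, sq_abs, mul_pow, ← Real.exp_nat_mul, ← pow_mul,
    mul_comm m 2]
  congr 2
  push_cast
  ring

lemma abs_normalizedBessel_le_one (hk : -(1 / 2) ≤ k) (x : ℝ) : |normalizedBessel k x| ≤ 1 := by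
  rw [← sq_le_one_iff_abs_le_one]
  nlinarith [normalizedBessel_sq_add_dunklOddPart_sq_le hk x, sq_nonneg (dunklOddPart k x)]

lemma abs_dunklOddPart_le_one (hk : -(1 / 2) ≤ k) (x : ℝ) : |dunklOddPart k x| ≤ 1 := by
  rw [← sq_le_one_iff_abs_le_one]
  nlinarith [normalizedBessel_sq_add_dunklOddPart_sq_le hk x, sq_nonneg (normalizedBessel k x)]

lemma integral_eq_zero_of_odd (f : ℝ → ℝ) (hf : ∀ x, f (-x) = -f x) :
    ∫ x, f x ∂(dunklMeasure k) = 0 := by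
  have h := integral_neg_eq_self f (dunklMeasure k)
  simp only [hf, integral_neg] at h
  linarith

lemma dunklTransform_gaussianAtom_eq (hk : -(1 / 2) ≤ k) (m : ℕ) {t : ℝ} (ht : 0 < t) (ξ : ℝ) :
    dunklTransform k (gaussianAtom m t) ξ
      = ((∫ x, x ^ m * Real.exp (-t * x ^ 2) * normalizedBessel k (ξ * x) ∂(dunklMeasure k) : ℝ) : ℂ)
        - Complex.I * ((∫ x, x ^ m * Real.exp (-t * x ^ 2) * dunklOddPart k (ξ * x)
          ∂(dunklMeasure k) : ℝ) : ℂ) := by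
  have h1 : Integrable (fun x => x ^ m * Real.exp (-t * x ^ 2) * normalizedBessel k (ξ * x))
      (dunklMeasure k) :=
    (integrable_pow_mul_gaussian hk m ht).mul_bdd (c := 1)
      ((continuous_normalizedBessel hk).comp (continuous_const_mul ξ)).aestronglyMeasurable
      (ae_of_all _ fun x => abs_normalizedBessel_le_one hk _)
  have h2 : Integrable (fun x => x ^ m * Real.exp (-t * x ^ 2) * dunklOddPart k (ξ * x))
      (dunklMeasure k) :=
    (integrable_pow_mul_gaussian hk m ht).mul_bdd (c := 1)
      ((continuous_dunklOddPart hk).comp (continuous_const_mul ξ)).aestronglyMeasurable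
      (ae_of_all _ fun x => abs_dunklOddPart_le_one hk _)
  rw [← integral_complex_ofReal, ← integral_complex_ofReal, ← integral_const_mul,
    ← integral_sub h1.ofReal (h2.ofReal.const_mul _)]
  refine integral_congr_ae (ae_of_all _ fun x => ?_)
  simp only [gaussianAtom, dunklKernel_eq]
  push_cast
  ring

lemma dunklTransform_gaussianAtom_zero (hk : -(1 / 2) ≤ k) {t : ℝ} (ht : 0 < t) :
    dunklTransform k (gaussianAtom 0 t)
      = (((2 * t) ^ (-(k + 1)) : ℝ) : ℂ) • gaussianAtom 0 (1 / (4 * t)) := by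
  funext ξ
  rw [dunklTransform_gaussianAtom_eq hk 0 ht,
    integral_eq_zero_of_odd (fun x => x ^ 0 * Real.exp (-t * x ^ 2) * dunklOddPart k (ξ * x))
      (fun x => by simp [dunklOddPart_neg])]
  have h := integral_normalizedBessel_mul_gaussian hk ht ξ
  simp only [pow_zero, one_mul, mul_comm (Real.exp _), h, gaussianAtom, Pi.smul_apply, smul_eq_mul]
  push_cast
  ring

lemma dunklTransform_gaussianAtom_one (hk : -(1 / 2) ≤ k) {t : ℝ} (ht : 0 < t) :
    dunklTransform k (gaussianAtom 1 t)
      = (-Complex.I * (((2 * t) ^ (-(k + 2)) : ℝ) : ℂ)) • gaussianAtom 1 (1 / (4 * t)) := by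
  funext ξ
  rw [dunklTransform_gaussianAtom_eq hk 1 ht,
    integral_eq_zero_of_odd (fun x => x ^ 1 * Real.exp (-t * x ^ 2) * normalizedBessel k (ξ * x))
      (fun x => by simp [normalizedBessel_neg])]
  have hk1 : (k + 1) ≠ 0 := by linarith
  -- `x² dμ_k = 2 (k + 1) dμ_{k+1}` reduces the odd part to Weber's integral of order `k + 1`.
  have hw : ∀ x, x ^ 2 * dunklWeight k x = 2 * (k + 1) * dunklWeight (k + 1) x := by
    intro x
    have hp : |x| ^ (2 * (k + 1) + 1) = |x| ^ (2 * k + 1) * x ^ 2 := by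
      rw [← sq_abs, ← Real.rpow_natCast, ← Real.rpow_add_of_nonneg (abs_nonneg _) (by linarith)
        (by norm_num)]
      congr 1
      push_cast
      ring
    have hG := Real.Gamma_pos_of_pos (s := k + 1) (by linarith)
    have h2 : (0 : ℝ) < 2 ^ (k + 1) := by positivity
    rw [dunklWeight, dunklWeight, hp, Real.Gamma_add_one hk1,
      Real.rpow_add_one (two_ne_zero) (k + 1)]
    generalize |x| ^ (2 * k + 1) = y
    field_simp
  have h := integral_normalizedBessel_mul_gaussian (k := k + 1) (by linarith) ht ξ
  have hodd : ∫ x, x ^ 1 * Real.exp (-t * x ^ 2) * dunklOddPart k (ξ * x) ∂(dunklMeasure k)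
      = ξ * ((2 * t) ^ (-(k + 2)) * Real.exp (-(1 / (4 * t)) * ξ ^ 2)) := by
    rw [show -(k + 2) = -(k + 1 + 1) by ring, ← h, integral_dunklMeasure hk,
      integral_dunklMeasure (k := k + 1) (by linarith), ← integral_const_mul]
    refine integral_congr_ae (ae_of_all _ fun x => ?_)
    simp only [dunklOddPart, smul_eq_mul]
    calc dunklWeight k x * (x ^ 1 * Real.exp (-t * x ^ 2) *
          (ξ * x / (2 * (k + 1)) * normalizedBessel (k + 1) (ξ * x)))
        = (x ^ 2 * dunklWeight k x) / (2 * (k + 1)) * ξ *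
          (normalizedBessel (k + 1) (ξ * x) * Real.exp (-t * x ^ 2)) := by ring
      _ = _ := by
        rw [hw]
        field_simp
  rw [hodd]
  simp only [gaussianAtom, Pi.smul_apply, smul_eq_mul]
  push_cast
  ring

/-- Gaussians determine a function: if `F` is orthogonal to all `exp(-t x²)` and `x exp(-t x²)`,
then `F` vanishes almost everywhere. -/
lemma ae_eq_zero_of_integral_gaussianAtom {F : ℝ → ℂ}
    (hint : ∀ m < 2, ∀ t : ℝ, 0 < t →
      Integrable (fun x => F x * gaussianAtom m t x) (dunklMeasure k))
    (hzero : ∀ m < 2, ∀ t : ℝ, 0 < t → ∫ x, F x * gaussianAtom m t x ∂(dunklMeasure k) = 0) :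
    F =ᵐ[dunklMeasure k] 0 := by
  -- The even functions `(F(x) + F(-x)) exp(-x²)` and `x (F(x) - F(-x)) exp(-x²)` vanish.
  have main : ∀ m < 2, (fun x => F x * gaussianAtom m 1 x + F (-x) * gaussianAtom m 1 (-x))
      =ᵐ[dunklMeasure k] 0 := by
    intro m hm
    refine ae_eq_zero_of_even_of_gaussian_moments
      ((hint m hm 1 one_pos).add (hint m hm 1 one_pos).comp_neg)
      (fun x => by simp only [neg_neg, add_comm]) fun n => ?_
    have hn : (0 : ℝ) < n + 1 := by positivity
    have hatom : ∀ x, gaussianAtom m 1 x * (Real.exp (-x ^ 2) : ℂ) ^ n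
        = gaussianAtom m (n + 1) x := by
      intro x
      simp only [gaussianAtom]
      rw [← Complex.ofReal_pow, ← Complex.ofReal_mul, ← Real.exp_nat_mul, mul_assoc, ← Real.exp_add]
      congr 3
      ring
    have hrw : ∀ x, (F x * gaussianAtom m 1 x + F (-x) * gaussianAtom m 1 (-x)) *
        (Real.exp (-x ^ 2) : ℂ) ^ n
        = F x * gaussianAtom m (n + 1) x + F (-x) * gaussianAtom m (n + 1) (-x) := by
      intro x
      rw [← hatom, ← hatom, neg_sq]
      ring
    have hi := hint m hm _ hn
    simp only [hrw]
    rw [integral_add hi hi.comp_neg,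
      integral_neg_eq_self (fun x => F x * gaussianAtom m (n + 1) x), hzero m hm _ hn, add_zero]
  have hne : ∀ᵐ x ∂(dunklMeasure k), x ≠ 0 := by
    refine (withDensity_absolutelyContinuous _ _).ae_le (Measure.ae_ne volume 0)
  filter_upwards [main 0 (by norm_num), main 1 (by norm_num), hne] with x h0 h1 hx
  simp only [gaussianAtom, neg_sq, pow_zero, pow_one, one_mul, Pi.zero_apply] at h0 h1
  push_cast at h0 h1
  have hx' : (x : ℂ) ≠ 0 := by exact_mod_cast hx
  have he : Complex.exp (-1 * (x : ℂ) ^ 2) ≠ 0 := Complex.exp_ne_zero _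
  have h2 : (x : ℂ) * Complex.exp (-1 * (x : ℂ) ^ 2) * (2 * F x) = 0 := by
    linear_combination (x : ℂ) * h0 + h1
  simpa [hx', he] using h2

/-! ### The Plancherel inequality -/

/-- The linear span of the functions `exp(-t x²)` and `x exp(-t x²)`, `t > 0`. -/
noncomputable def gaussianSpan : Submodule ℂ (ℝ → ℂ) :=
  Submodule.span ℂ {g | ∃ m < 2, ∃ t : ℝ, 0 < t ∧ g = gaussianAtom m t}

lemma gaussianAtom_mem_gaussianSpan {m : ℕ} (hm : m < 2) {t : ℝ} (ht : 0 < t) :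
    gaussianAtom m t ∈ gaussianSpan :=
  Submodule.subset_span ⟨m, hm, t, ht, rfl⟩

lemma integrable_of_mem_gaussianSpan (hk : -(1 / 2) ≤ k) {g : ℝ → ℂ} (hg : g ∈ gaussianSpan) :
    Integrable g (dunklMeasure k) := by
  induction hg using Submodule.span_induction with
  | mem g hg =>
    obtain ⟨m, _, t, ht, rfl⟩ := hg
    exact integrable_gaussianAtom hk m ht
  | zero => exact integrable_zero _ _ _
  | add f g _ _ hf hg => exact hf.add hg
  | smul c f _ hf => exact hf.smul c

lemma memLp_two_of_mem_gaussianSpan (hk : -(1 / 2) ≤ k) {g : ℝ → ℂ} (hg : g ∈ gaussianSpan) :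
    MemLp g 2 (dunklMeasure k) := by
  induction hg using Submodule.span_induction with
  | mem g hg =>
    obtain ⟨m, _, t, ht, rfl⟩ := hg
    exact memLp_two_gaussianAtom hk m ht
  | zero => exact MemLp.zero
  | add f g _ _ hf hg => exact hf.add hg
  | smul c f _ hf => exact hf.const_smul c

lemma conj_mem_gaussianSpan {g : ℝ → ℂ} (hg : g ∈ gaussianSpan) :
    (fun x => conj (g x)) ∈ gaussianSpan := by
  induction hg using Submodule.span_induction with
  | mem g hg =>
    obtain ⟨m, hm, t, ht, rfl⟩ := hg
    have h : (fun x => conj (gaussianAtom m t x)) = gaussianAtom m t :=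
      funext fun x => Complex.conj_ofReal _
    rw [h]
    exact gaussianAtom_mem_gaussianSpan hm ht
  | zero =>
    simp only [Pi.zero_apply, map_zero]
    exact gaussianSpan.zero_mem
  | add f g _ _ hf hg =>
    simp only [Pi.add_apply, map_add]
    exact gaussianSpan.add_mem hf hg
  | smul c f _ hf =>
    simp only [Pi.smul_apply, smul_eq_mul, map_mul]
    exact gaussianSpan.smul_mem (conj c) hf

lemma dunklTransform_gaussianAtom (hk : -(1 / 2) ≤ k) {m : ℕ} (hm : m < 2) {t : ℝ} (ht : 0 < t) :
    dunklTransform k (gaussianAtom m t)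
      = ((-Complex.I) ^ m * (((2 * t) ^ (-(k + 1 + m)) : ℝ) : ℂ)) •
        gaussianAtom m (1 / (4 * t)) := by
  interval_cases m
  · rw [dunklTransform_gaussianAtom_zero hk ht]
    simp
  · rw [dunklTransform_gaussianAtom_one hk ht, show k + 2 = k + 1 + ((1 : ℕ) : ℝ) by push_cast; ring]
    simp

lemma dunklTransform_mem_gaussianSpan (hk : -(1 / 2) ≤ k) {g : ℝ → ℂ} (hg : g ∈ gaussianSpan) :
    dunklTransform k g ∈ gaussianSpan := by
  induction hg using Submodule.span_induction with
  | mem g hg =>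
    obtain ⟨m, hm, t, ht, rfl⟩ := hg
    rw [dunklTransform_gaussianAtom hk hm ht]
    exact gaussianSpan.smul_mem _ (gaussianAtom_mem_gaussianSpan hm (by positivity))
  | zero =>
    rw [dunklTransform_zero]
    exact gaussianSpan.zero_mem
  | add f g hf' hg' hf hg =>
    rw [dunklTransform_add hk (integrable_of_mem_gaussianSpan hk hf')
      (integrable_of_mem_gaussianSpan hk hg')]
    exact gaussianSpan.add_mem hf hg
  | smul c f _ hf =>
    rw [dunklTransform_smul]
    exact gaussianSpan.smul_mem _ hf

/-- The inversion formula on the span of the Gaussians. -/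
lemma dunklTransform_dunklTransform (hk : -(1 / 2) ≤ k) {g : ℝ → ℂ} (hg : g ∈ gaussianSpan) :
    dunklTransform k (dunklTransform k g) = fun x => g (-x) := by
  induction hg using Submodule.span_induction with
  | mem g hg =>
    obtain ⟨m, hm, t, ht, rfl⟩ := hg
    have ht' : 0 < 1 / (4 * t) := by positivity
    rw [dunklTransform_gaussianAtom hk hm ht, dunklTransform_smul,
      dunklTransform_gaussianAtom hk hm ht', smul_smul]
    funext x
    have h1 : (2 * t) ^ (-(k + 1 + m)) * (2 * (1 / (4 * t))) ^ (-(k + 1 + m)) = 1 := by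
      rw [← Real.mul_rpow (by positivity) (by positivity),
        show 2 * t * (2 * (1 / (4 * t))) = 1 by field_simp; norm_num, Real.one_rpow]
    have h2 : (((2 * t) ^ (-(k + 1 + m)) : ℝ) : ℂ) *
        (((2 * (1 / (4 * t))) ^ (-(k + 1 + m)) : ℝ) : ℂ) = 1 := by
      rw [← Complex.ofReal_mul, h1, Complex.ofReal_one]
    rw [mul_mul_mul_comm, h2, ← mul_pow, neg_mul_neg, Complex.I_mul_I, mul_one,
      show 1 / (4 * (1 / (4 * t))) = t by field_simp]
    simp only [Pi.smul_apply, smul_eq_mul, gaussianAtom]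
    push_cast
    rw [← mul_assoc, ← mul_pow, neg_one_mul, neg_sq]
  | zero =>
    rw [dunklTransform_zero, dunklTransform_zero]
    rfl
  | add f g hf' hg' hf hg =>
    rw [dunklTransform_add hk (integrable_of_mem_gaussianSpan hk hf')
      (integrable_of_mem_gaussianSpan hk hg'),
      dunklTransform_add hk
        (integrable_of_mem_gaussianSpan hk (dunklTransform_mem_gaussianSpan hk hf'))
        (integrable_of_mem_gaussianSpan hk (dunklTransform_mem_gaussianSpan hk hg')), hf, hg]
    rfl
  | smul c f _ hf =>
    rw [dunklTransform_smul, dunklTransform_smul, hf]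
    rfl

lemma eLpNorm_two_eq {μ : Measure ℝ} {g : ℝ → ℂ} (hg : MemLp g 2 μ) :
    eLpNorm g 2 μ = ENNReal.ofReal ((∫ x, g x * conj (g x) ∂μ).re ^ (2⁻¹ : ℝ)) := by
  rw [hg.eLpNorm_eq_integral_rpow_norm (by norm_num) (by norm_num)]
  have h : ∀ x, g x * conj (g x) = ((‖g x‖ ^ (2 : ℝ) : ℝ) : ℂ) := by
    intro x
    rw [Complex.mul_conj, Complex.normSq_eq_norm_sq, Real.rpow_two]
  simp only [h, integral_complex_ofReal, Complex.ofReal_re, ENNReal.toReal_ofNat]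

lemma eLpNorm_dunklTransform_of_mem_gaussianSpan (hk : -(1 / 2) ≤ k) {g : ℝ → ℂ}
    (hg : g ∈ gaussianSpan) :
    eLpNorm (dunklTransform k g) 2 (dunklMeasure k) = eLpNorm g 2 (dunklMeasure k) := by
  have hDg := dunklTransform_mem_gaussianSpan hk hg
  rw [eLpNorm_two_eq (memLp_two_of_mem_gaussianSpan hk hDg),
    eLpNorm_two_eq (memLp_two_of_mem_gaussianSpan hk hg),
    integral_dunklTransform_mul hk (integrable_of_mem_gaussianSpan hk hg)
      (integrable_of_mem_gaussianSpan hk (conj_mem_gaussianSpan hDg))]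
  simp only [dunklTransform_conj, dunklTransform_dunklTransform hk hg, neg_neg]

lemma exists_seq_gaussianSpan_tendsto (hk : -(1 / 2) ≤ k) {f : ℝ → ℂ}
    (hf : MemLp f 2 (dunklMeasure k)) :
    ∃ u : ℕ → ℝ → ℂ, (∀ n, u n ∈ gaussianSpan) ∧
      Tendsto (fun n => eLpNorm (u n - f) 2 (dunklMeasure k)) atTop (𝓝 0) := by
  set V : Submodule ℂ (Lp ℂ 2 (dunklMeasure k)) :=
    Submodule.span ℂ {F | ∃ g ∈ gaussianSpan, F =ᵐ[dunklMeasure k] g} with hV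
  have hVmem : ∀ F ∈ V, ∃ g ∈ gaussianSpan, F =ᵐ[dunklMeasure k] g := by
    intro F hF
    induction hF using Submodule.span_induction with
    | mem F hF => exact hF
    | zero => exact ⟨0, gaussianSpan.zero_mem, Lp.coeFn_zero _ _ _⟩
    | add F G _ _ hF hG =>
      obtain ⟨f, hf, hFf⟩ := hF
      obtain ⟨g, hg, hGg⟩ := hG
      exact ⟨f + g, gaussianSpan.add_mem hf hg, (Lp.coeFn_add F G).trans (hFf.add hGg)⟩
    | smul c F _ hF =>
      obtain ⟨f, hf, hFf⟩ := hF
      exact ⟨c • f, gaussianSpan.smul_mem c hf, (Lp.coeFn_smul c F).trans (hFf.const_smul c)⟩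
  have hdense : V.topologicalClosure = ⊤ := by
    rw [Submodule.topologicalClosure_eq_top_iff, Submodule.eq_bot_iff]
    intro F hF
    rw [Lp.eq_zero_iff_ae_eq_zero]
    refine ae_eq_zero_of_integral_gaussianAtom (fun m hm t ht => ?_) fun m hm t ht => ?_
    · exact (Lp.memLp F).integrable_mul_of_holderConjugate (memLp_two_gaussianAtom hk m ht)
    · have ha := memLp_two_gaussianAtom hk m ht
      have h0 := (Submodule.mem_orthogonal V F).1 hF (ha.toLp _)
        (Submodule.subset_span ⟨_, gaussianAtom_mem_gaussianSpan hm ht, ha.coeFn_toLp⟩)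
      rw [L2.inner_def] at h0
      rw [← h0]
      refine integral_congr_ae ?_
      filter_upwards [ha.coeFn_toLp] with x hx
      rw [hx, RCLike.inner_apply, gaussianAtom, Complex.conj_ofReal]
  have hfV : hf.toLp f ∈ closure (V : Set (Lp ℂ 2 (dunklMeasure k))) := by
    rw [← Submodule.topologicalClosure_coe, hdense]
    trivial
  obtain ⟨v, hv, hlim⟩ := mem_closure_iff_seq_limit.1 hfV
  choose u hu hvu using fun n => hVmem (v n) (hv n)
  refine ⟨u, hu, ?_⟩
  rw [Lp.tendsto_Lp_iff_tendsto_eLpNorm'] at hlim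
  refine hlim.congr fun n => eLpNorm_congr_ae ?_
  filter_upwards [hvu n, hf.coeFn_toLp] with x h1 h2
  simp [h1, h2]

/-- The Dunkl transform is a contraction of `L²`. The Gaussian approximants give a limit `h` in
`L²` of norm at most that of `f`, and `h` agrees with the integral defining the transform because
both have the same pairing with every Gaussian. -/
lemma eLpNorm_two_dunklTransform_le (hk : -(1 / 2) ≤ k) {f : ℝ → ℂ}
    (hf1 : Integrable f (dunklMeasure k)) (hf2 : MemLp f 2 (dunklMeasure k)) :
    eLpNorm (dunklTransform k f) 2 (dunklMeasure k) ≤ eLpNorm f 2 (dunklMeasure k) := by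
  obtain ⟨u, hu, hlim⟩ := exists_seq_gaussianSpan_tendsto hk hf2
  have hu2 : ∀ n, MemLp (u n) 2 (dunklMeasure k) := fun n => memLp_two_of_mem_gaussianSpan hk (hu n)
  have hDu : ∀ n, dunklTransform k (u n) ∈ gaussianSpan := fun n =>
    dunklTransform_mem_gaussianSpan hk (hu n)
  have hDu2 := fun n => memLp_two_of_mem_gaussianSpan hk (hDu n)
  have hsub : ∀ n m, dunklTransform k (u n) - dunklTransform k (u m)
      = dunklTransform k (u n - u m) := by
    intro n m
    rw [sub_eq_add_neg, sub_eq_add_neg, ← neg_one_smul ℂ (u m), ← neg_one_smul ℂ (dunklTransform k _),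
      ← dunklTransform_smul, ← dunklTransform_add hk (integrable_of_mem_gaussianSpan hk (hu n))
      (integrable_of_mem_gaussianSpan hk (gaussianSpan.smul_mem _ (hu m)))]
  obtain ⟨h, hh, hhlim⟩ := exists_tendsto_eLpNorm_of_le (C := 1) one_le_two one_le_two (by simp)
    hu2 hf2 hDu2 (fun n m => by
      rw [hsub, one_mul,
        eLpNorm_dunklTransform_of_mem_gaussianSpan hk (gaussianSpan.sub_mem (hu n) (hu m))]) hlim
  have heq : dunklTransform k f =ᵐ[dunklMeasure k] h := by
    have hi1 : ∀ m : ℕ, ∀ t : ℝ, 0 < t →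
        Integrable (fun x => dunklTransform k f x * gaussianAtom m t x) (dunklMeasure k) :=
      fun m t ht => (integrable_gaussianAtom hk m ht).bdd_mul
        (c := ∫ x, ‖f x‖ ∂(dunklMeasure k))
        (continuous_dunklTransform hk hf1).aestronglyMeasurable
        (ae_of_all _ (norm_dunklTransform_le hk hf1))
    have hi2 : ∀ m : ℕ, ∀ t : ℝ, 0 < t →
        Integrable (fun x => h x * gaussianAtom m t x) (dunklMeasure k) := fun m t ht =>
      hh.integrable_mul_of_holderConjugate (memLp_two_gaussianAtom hk m ht)
    have h0 := ae_eq_zero_of_integral_gaussianAtom (F := fun x => dunklTransform k f x - h x)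
      (fun m _ t ht => by
        simp only [sub_mul]
        exact (hi1 m t ht).sub (hi2 m t ht)) fun m hm t ht => by
      simp only [sub_mul]
      rw [integral_sub (hi1 m t ht) (hi2 m t ht), sub_eq_zero]
      have hatom := integrable_gaussianAtom hk m ht
      have hDa := memLp_two_of_mem_gaussianSpan hk
        (dunklTransform_mem_gaussianSpan hk (gaussianAtom_mem_gaussianSpan hm ht))
      have l1 := tendsto_integral_mul_of_tendsto_eLpNorm (q := 2) hDu2 hh
        (memLp_two_gaussianAtom hk m ht) hhlim
      have l2 := tendsto_integral_mul_of_tendsto_eLpNorm (q := 2) hu2 hf2 hDa hlim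
      simp only [integral_dunklTransform_mul hk (integrable_of_mem_gaussianSpan hk (hu _)) hatom]
        at l1
      rw [integral_dunklTransform_mul hk hf1 hatom]
      exact tendsto_nhds_unique l2 l1
    filter_upwards [h0] with x hx
    exact sub_eq_zero.1 hx
  rw [eLpNorm_congr_ae heq]
  have hlim2 : Tendsto (fun n => eLpNorm (dunklTransform k (u n) - h) 2 (dunklMeasure k) +
      (eLpNorm (u n - f) 2 (dunklMeasure k) + eLpNorm f 2 (dunklMeasure k))) atTop
      (𝓝 (0 + (0 + eLpNorm f 2 (dunklMeasure k)))) :=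
    hhlim.add (hlim.add tendsto_const_nhds)
  rw [zero_add, zero_add] at hlim2
  refine ge_of_tendsto' hlim2 fun n => ?_
  calc eLpNorm h 2 (dunklMeasure k)
      = eLpNorm (dunklTransform k (u n) - (dunklTransform k (u n) - h)) 2 (dunklMeasure k) := by
        rw [sub_sub_cancel]
    _ ≤ eLpNorm (dunklTransform k (u n)) 2 (dunklMeasure k) +
        eLpNorm (dunklTransform k (u n) - h) 2 (dunklMeasure k) :=
      eLpNorm_sub_le (hDu2 n).1 ((hDu2 n).sub hh).1 one_le_two
    _ = eLpNorm (dunklTransform k (u n) - h) 2 (dunklMeasure k) +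
        eLpNorm ((u n - f) + f) 2 (dunklMeasure k) := by
      rw [eLpNorm_dunklTransform_of_mem_gaussianSpan hk (hu n), add_comm, sub_add_cancel]
    _ ≤ _ := by
      gcongr
      exact eLpNorm_add_le ((hu2 n).sub hf2).1 hf2.1 one_le_two

end Transform

/-! ### Riesz–Thorin interpolation between `L¹ → L^∞` and `L² → L²` -/

/-- `T` is a linear operator on integrable functions which maps `L¹` to `L^∞` with norm at most `A`
(with a pointwise bound everywhere) and is a contraction for the `L²` norm. -/
structure IsL1L2Bounded {X : Type*} [MeasurableSpace X] (μ : Measure X)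
    (T : (X → ℂ) → X → ℂ) (A : ℝ) : Prop where
  add : ∀ f g, Integrable f μ → Integrable g μ → T (f + g) = T f + T g
  smul : ∀ (c : ℂ) f, T (c • f) = c • T f
  aestronglyMeasurable : ∀ f, Integrable f μ → AEStronglyMeasurable (T f) μ
  norm_le : ∀ f, Integrable f μ → ∀ x, ‖T f x‖ ≤ A * ∫ x, ‖f x‖ ∂μ
  eLpNorm_two_le : ∀ f, Integrable f μ → MemLp f 2 μ → eLpNorm (T f) 2 μ ≤ eLpNorm f 2 μ

/-- The analytic family of powers `y ↦ |y|^{p (1 - z/2)} y / |y|`, whose value at `z = 2 - 2/p` is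
the identity. -/
noncomputable def analyticPower (p : ℝ) (z y : ℂ) : ℂ :=
  if y = 0 then 0 else ((‖y‖ : ℝ) : ℂ) ^ ((p : ℂ) * (1 - z / 2)) * (y / (‖y‖ : ℝ))

lemma norm_analyticPower {p : ℝ} (hp : 0 < p) {z : ℂ} (hz : z.re ≤ 1) (y : ℂ) :
    ‖analyticPower p z y‖ = ‖y‖ ^ (p * (1 - z.re / 2)) := by
  have hre : ((p : ℂ) * (1 - z / 2)).re = p * (1 - z.re / 2) := by simp
  have hpos : 0 < p * (1 - z.re / 2) := mul_pos hp (by linarith)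
  by_cases hy : y = 0
  · simp [analyticPower, hy, Real.zero_rpow hpos.ne']
  · have hy' : 0 < ‖y‖ := norm_pos_iff.2 hy
    rw [analyticPower, if_neg hy, norm_mul, Complex.norm_cpow_eq_rpow_re_of_pos hy', hre, norm_div,
      Complex.norm_real, norm_norm, div_self hy'.ne', mul_one]

lemma analyticPower_zero (p : ℝ) (z : ℂ) : analyticPower p z 0 = 0 := if_pos rfl

lemma analyticPower_eq_self {p q : ℝ} (hpq : p.HolderConjugate q) (y : ℂ) :
    analyticPower p ((2 / q : ℝ) : ℂ) y = y := by
  by_cases hy : y = 0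
  · rw [hy, analyticPower_zero]
  · have hy' : ((‖y‖ : ℝ) : ℂ) ≠ 0 := by simpa using hy
    have h : (p : ℂ) * (1 - ((2 / q : ℝ) : ℂ) / 2) = 1 := by
      have h1 := hpq.inv_add_inv_eq_one
      have h2 := hpq.ne_zero
      have h3 : p * (1 - 2 / q / 2) = 1 := by
        rw [show (1 : ℝ) - 2 / q / 2 = p⁻¹ by rw [← h1]; ring]
        exact mul_inv_cancel₀ h2
      exact_mod_cast h3
    rw [analyticPower, if_neg hy, h, Complex.cpow_one, mul_div_cancel₀ _ hy']

lemma differentiable_analyticPower (p : ℝ) (y : ℂ) :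
    Differentiable ℂ fun z => analyticPower p z y := by
  by_cases hy : y = 0
  · simp only [hy, analyticPower_zero]
    exact differentiable_const 0
  · have hy' : ((‖y‖ : ℝ) : ℂ) ≠ 0 := by simpa using hy
    simp only [analyticPower, if_neg hy]
    refine Differentiable.mul_const ?_ _
    exact Differentiable.const_cpow (by fun_prop) (Or.inl hy')

lemma norm_analyticPower_le {p : ℝ} (hp : 0 < p) {z : ℂ} (hz0 : 0 ≤ z.re) (hz : z.re ≤ 1) (y : ℂ) :
    ‖analyticPower p z y‖ ≤ ‖y‖ ^ p + ‖y‖ ^ (p / 2) := by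
  rw [norm_analyticPower hp hz]
  have h1 : 0 ≤ ‖y‖ ^ p := by positivity
  have h2 : 0 ≤ ‖y‖ ^ (p / 2) := by positivity
  rcases le_total ‖y‖ 1 with hy | hy
  · have := Real.rpow_le_rpow_of_exponent_ge' (norm_nonneg y) hy (by positivity)
      (by nlinarith : p / 2 ≤ p * (1 - z.re / 2))
    linarith
  · have := Real.rpow_le_rpow_of_exponent_le hy (by nlinarith : p * (1 - z.re / 2) ≤ p)
    linarith

section RieszThorin

variable {X : Type*} [MeasurableSpace X] {μ : Measure X} {T : (X → ℂ) → X → ℂ} {A : ℝ}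

namespace IsL1L2Bounded

lemma zero (hT : IsL1L2Bounded μ T A) : T 0 = 0 := by
  have := hT.smul 0 0
  simpa using this

lemma sub (hT : IsL1L2Bounded μ T A) {f g : X → ℂ} (hf : Integrable f μ) (hg : Integrable g μ) :
    T (f - g) = T f - T g := by
  rw [sub_eq_add_neg, sub_eq_add_neg, ← neg_one_smul ℂ g, ← neg_one_smul ℂ (T g), ← hT.smul,
    ← hT.add f _ hf (hg.smul (-1 : ℂ))]

lemma sum_smul (hT : IsL1L2Bounded μ T A) {ι : Type*} (s : Finset ι) (c : ι → ℂ) (e : ι → X → ℂ)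
    (he : ∀ i ∈ s, Integrable (e i) μ) :
    T (∑ i ∈ s, c i • e i) = ∑ i ∈ s, c i • T (e i) := by
  classical
  induction s using Finset.induction_on with
  | empty => simpa using hT.zero
  | insert i s hi ih =>
    have hs : ∀ j ∈ s, Integrable (e j) μ := fun j hj => he j (Finset.mem_insert_of_mem hj)
    rw [Finset.sum_insert hi, Finset.sum_insert hi, hT.add _ _
      ((he i (Finset.mem_insert_self i s)).smul (c i))
      (integrable_finsetSum' s fun j hj => (hs j hj).smul (c j)), hT.smul, ih hs]

lemma integrable_mul (hT : IsL1L2Bounded μ T A) {f g : X → ℂ} (hf : Integrable f μ)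
    (hg : Integrable g μ) : Integrable (fun x => T f x * g x) μ :=
  hg.bdd_mul (hT.aestronglyMeasurable f hf) (ae_of_all _ (hT.norm_le f hf))

lemma norm_integral_mul_le (hT : IsL1L2Bounded μ T A) {f g : X → ℂ} (hf : Integrable f μ)
    (hg : Integrable g μ) :
    ‖∫ x, T f x * g x ∂μ‖ ≤ A * (∫ x, ‖f x‖ ∂μ) * ∫ x, ‖g x‖ ∂μ := by
  rw [← integral_const_mul]
  refine norm_integral_le_of_norm_le (hg.norm.const_mul _) (ae_of_all _ fun x => ?_)
  rw [norm_mul]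
  exact mul_le_mul_of_nonneg_right (hT.norm_le f hf x) (norm_nonneg _)

lemma memLp_two (hT : IsL1L2Bounded μ T A) {f : X → ℂ} (hf : Integrable f μ) (hf2 : MemLp f 2 μ) :
    MemLp (T f) 2 μ :=
  ⟨hT.aestronglyMeasurable f hf, (hT.eLpNorm_two_le f hf hf2).trans_lt hf2.2⟩

lemma norm_integral_mul_le_two (hT : IsL1L2Bounded μ T A) {f g : X → ℂ} (hf : Integrable f μ)
    (hf2 : MemLp f 2 μ) (hg2 : MemLp g 2 μ) :
    ‖∫ x, T f x * g x ∂μ‖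
      ≤ (∫ x, ‖f x‖ ^ (2 : ℝ) ∂μ) ^ (2⁻¹ : ℝ) * (∫ x, ‖g x‖ ^ (2 : ℝ) ∂μ) ^ (2⁻¹ : ℝ) := by
  have h := integral_mul_enorm_le (p := 2) (q := 2) (hT.aestronglyMeasurable f hf) hg2.1
  have h2 := h.trans (mul_le_mul_left (hT.eLpNorm_two_le f hf hf2) _)
  rw [hf2.eLpNorm_eq_integral_rpow_norm (by norm_num) (by norm_num),
    hg2.eLpNorm_eq_integral_rpow_norm (by norm_num) (by norm_num),
    ← ENNReal.ofReal_mul (by positivity), ← ofReal_norm, ENNReal.toReal_ofNat] at h2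
  exact (ENNReal.ofReal_le_ofReal_iff (by positivity)).1 h2

/-- The bilinear form of Riesz–Thorin interpolation: Hadamard's three lines theorem for
`z ↦ ∫ T(f_z) g_z`, where `f_z`, `g_z` are the analytic powers of `f` and `g`. -/
lemma norm_integral_mul_le_interp (hT : IsL1L2Bounded μ T A) (hA : 0 ≤ A) {p q : ℝ}
    (hpq : p.HolderConjugate q) (hp2 : p ≤ 2) (f g : SimpleFunc X ℂ) (hf : Integrable f μ)
    (hg : Integrable g μ) :
    ‖∫ x, T f x * g x ∂μ‖
      ≤ A ^ (1 - 2 / q) * (∫ x, ‖f x‖ ^ p ∂μ) ^ (1 / p) * (∫ x, ‖g x‖ ^ p ∂μ) ^ (1 / p) := by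
  classical
  have hp0 : 0 < p := hpq.pos
  have hq0 : 0 < q := hpq.symm.pos
  have hinv : 1 / p + 1 / q = 1 := by simpa using hpq.inv_add_inv_eq_one
  have hq2 : 2 / q ≤ 1 := by
    have : 1 / 2 ≤ 1 / p := one_div_le_one_div_of_le hp0 hp2
    rw [show (2 : ℝ) / q = 2 * (1 / q) by ring]
    linarith
  -- The powers of a simple function are simple functions of finite measure support.
  have hint : ∀ (h : SimpleFunc X ℂ), Integrable h μ → ∀ z : ℂ,
      Integrable (fun x => analyticPower p z (h x)) μ ∧
      MemLp (fun x => analyticPower p z (h x)) 2 μ := by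
    intro h hh z
    have hfin : (h.map (analyticPower p z)).FinMeasSupp μ :=
      (SimpleFunc.integrable_iff_finMeasSupp.1 hh).map (analyticPower_zero p z)
    exact ⟨SimpleFunc.integrable_iff_finMeasSupp.2 hfin,
      (SimpleFunc.memLp_iff_finMeasSupp (by norm_num) (by norm_num)).2 hfin⟩
  set S : SimpleFunc X ℂ → Finset ℂ := fun h => h.range.filter (· ≠ 0) with hS
  set e : SimpleFunc X ℂ → ℂ → X → ℂ := fun h y => (h ⁻¹' {y}).indicator 1 with he
  have hdecomp : ∀ (h : SimpleFunc X ℂ) (z : ℂ),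
      (fun x => analyticPower p z (h x)) = ∑ y ∈ S h, analyticPower p z y • e h y := by
    intro h z
    funext x
    simp only [Finset.sum_apply, Pi.smul_apply, smul_eq_mul, hS, he]
    rw [Finset.sum_eq_single (h x)]
    · simp
    · intro y _ hy
      rw [indicator_of_notMem (fun hx => hy hx.symm), mul_zero]
    · intro hx
      have : h x = 0 := by
        by_contra h0
        exact hx (Finset.mem_filter.2 ⟨h.mem_range_self x, h0⟩)
      simp [this, analyticPower_zero]
  have heint : ∀ h : SimpleFunc X ℂ, Integrable h μ → ∀ y ∈ S h, Integrable (e h y) μ := by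
    intro h hh y hy
    have hfin := SimpleFunc.integrable_iff.1 hh y (Finset.mem_filter.1 hy).2
    exact (integrable_indicator_iff (h.measurableSet_fiber y)).2
      (integrableOn_const (hs := hfin.ne))
  set F : ℂ → ℂ := fun z => ∫ x, T (fun x => analyticPower p z (f x)) x *
    analyticPower p z (g x) ∂μ with hF
  have hFsum : F = fun z => ∑ y ∈ S f, ∑ w ∈ S g, analyticPower p z y * analyticPower p z w *
      ∫ x, T (e f y) x * e g w x ∂μ := by
    funext z
    simp only [hF]
    have hg' : ∀ x, analyticPower p z (g x) = ∑ w ∈ S g, analyticPower p z w * e g w x := by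
      intro x
      have := congrFun (hdecomp g z) x
      simpa only [Finset.sum_apply, Pi.smul_apply, smul_eq_mul] using this
    simp only [hg']
    rw [hdecomp f z, hT.sum_smul _ _ _ (heint f hf)]
    simp only [Finset.sum_apply, Pi.smul_apply, smul_eq_mul, Finset.sum_mul_sum]
    have hterm : ∀ y ∈ S f, ∀ w ∈ S g, Integrable (fun x =>
        analyticPower p z y * T (e f y) x * (analyticPower p z w * e g w x)) μ := by
      intro y hy w hw
      refine ((hT.integrable_mul (heint f hf y hy) (heint g hg w hw)).const_mul
        (analyticPower p z y * analyticPower p z w)).congr (ae_of_all _ fun x => ?_)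
      simp only
      ring
    rw [integral_finsetSum _ fun y hy => integrable_finsetSum _ fun w hw => hterm y hy w hw]
    refine Finset.sum_congr rfl fun y hy => ?_
    rw [integral_finsetSum _ fun w hw => hterm y hy w hw]
    refine Finset.sum_congr rfl fun w _ => ?_
    rw [← integral_const_mul]
    refine integral_congr_ae (ae_of_all _ fun x => ?_)
    simp only
    ring
  have hdiff : Differentiable ℂ F := by
    rw [hFsum]
    refine Differentiable.fun_sum fun y _ => Differentiable.fun_sum fun w _ => ?_
    exact ((differentiable_analyticPower p y).mul (differentiable_analyticPower p w)).mul_const _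
  have hbdd : BddAbove ((norm ∘ F) '' Complex.HadamardThreeLines.verticalClosedStrip 0 1) := by
    refine ⟨∑ y ∈ S f, ∑ w ∈ S g, (‖y‖ ^ p + ‖y‖ ^ (p / 2)) * (‖w‖ ^ p + ‖w‖ ^ (p / 2)) *
      ‖∫ x, T (e f y) x * e g w x ∂μ‖, ?_⟩
    rintro _ ⟨z, hz, rfl⟩
    have hz' : 0 ≤ z.re ∧ z.re ≤ 1 := hz
    simp only [Function.comp, hFsum]
    refine (norm_sum_le _ _).trans (Finset.sum_le_sum fun y _ =>
      (norm_sum_le _ _).trans (Finset.sum_le_sum fun w _ => ?_))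
    rw [norm_mul, norm_mul]
    have h1 := norm_analyticPower_le hp0 hz'.1 hz'.2 y
    have h2 := norm_analyticPower_le hp0 hz'.1 hz'.2 w
    gcongr
  set N : SimpleFunc X ℂ → ℝ := fun h => ∫ x, ‖h x‖ ^ p ∂μ with hN
  have hN0 : ∀ h, 0 ≤ N h := fun h => integral_nonneg fun x => by positivity
  have hleft : ∀ z ∈ Complex.re ⁻¹' {0}, ‖F z‖ ≤ A * (N f * N g) := by
    intro z hz
    have hz' : z.re = 0 := hz
    have h := hT.norm_integral_mul_le (hint f hf z).1 (hint g hg z).1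
    simp only [norm_analyticPower hp0 (hz'.le.trans zero_le_one), hz', zero_div, sub_zero,
      mul_one] at h
    rw [← mul_assoc]
    exact h
  have hright : ∀ z ∈ Complex.re ⁻¹' {1}, ‖F z‖ ≤ (N f * N g) ^ (2⁻¹ : ℝ) := by
    intro z hz
    have hz' : z.re = 1 := hz
    have h := hT.norm_integral_mul_le_two (hint f hf z).1 (hint f hf z).2 (hint g hg z).2
    simp only [norm_analyticPower hp0 hz'.le, hz', ← Real.rpow_mul (norm_nonneg _)] at h
    rw [show p * (1 - 1 / 2) * 2 = p by ring] at h
    rw [Real.mul_rpow (hN0 f) (hN0 g)]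
    exact h
  have hθ : ((2 / q : ℝ) : ℂ) ∈ Complex.HadamardThreeLines.verticalClosedStrip 0 1 := by
    change (((2 / q : ℝ) : ℂ)).re ∈ Icc (0 : ℝ) 1
    rw [Complex.ofReal_re]
    exact ⟨by positivity, hq2⟩
  have key := Complex.HadamardThreeLines.norm_le_interp_of_mem_verticalClosedStrip₀₁' F hθ
    hdiff.diffContOnCl hbdd hleft hright
  simp only [hF, analyticPower_eq_self hpq, Complex.ofReal_re] at key
  refine key.trans (le_of_eq ?_)
  have hNN : 0 ≤ N f * N g := mul_nonneg (hN0 f) (hN0 g)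
  rw [Real.mul_rpow hA hNN, ← Real.rpow_mul hNN, mul_assoc,
    ← Real.rpow_add_of_nonneg hNN (by linarith) (by positivity),
    show 1 - 2 / q + 2⁻¹ * (2 / q) = 1 / p by
      rw [eq_sub_of_add_eq hinv]
      ring, Real.mul_rpow (hN0 f) (hN0 g), mul_assoc]

end IsL1L2Bounded

/-- A function in two `L^p` spaces is a limit of simple functions in both at once. -/
lemma exists_simpleFunc_tendsto_eLpNorm {p₁ p₂ : ℝ≥0∞} (h₁ : p₁ ≠ ∞) (h₂ : p₂ ≠ ∞) {f : X → ℂ}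
    (hf₁ : MemLp f p₁ μ) (hf₂ : MemLp f p₂ μ) :
    ∃ u : ℕ → SimpleFunc X ℂ, (∀ n, MemLp (u n) p₁ μ ∧ MemLp (u n) p₂ μ) ∧
      Tendsto (fun n => eLpNorm (⇑(u n) - f) p₁ μ) atTop (𝓝 0) ∧
      Tendsto (fun n => eLpNorm (⇑(u n) - f) p₂ μ) atTop (𝓝 0) := by
  set f' := hf₁.1.mk f with hf'
  have hff' : f =ᵐ[μ] f' := hf₁.1.ae_eq_mk
  have hm : Measurable f' := hf₁.1.stronglyMeasurable_mk.measurable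
  have hf'₁ : MemLp f' p₁ μ := hf₁.ae_eq hff'
  have hf'₂ : MemLp f' p₂ μ := hf₂.ae_eq hff'
  have hconv : ∀ p : ℝ≥0∞, ∀ v : X → ℂ, eLpNorm (v - f') p μ = eLpNorm (v - f) p μ := fun p v =>
    eLpNorm_congr_ae (hff'.symm.mono fun x hx => by simp [hx])
  have l1 := SimpleFunc.tendsto_approxOn_range_Lp_eLpNorm h₁ hm hf'₁.2
  have l2 := SimpleFunc.tendsto_approxOn_range_Lp_eLpNorm h₂ hm hf'₂.2
  simp only [hconv] at l1 l2
  exact ⟨_, fun n => ⟨SimpleFunc.memLp_approxOn_range hm hf'₁ n,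
    SimpleFunc.memLp_approxOn_range hm hf'₂ n⟩, l1, l2⟩

/-- The converse of Hölder's inequality, tested on simple functions only. -/
lemma eLpNorm_le_of_forall_simpleFunc {p q : ℝ} (hpq : p.HolderConjugate q) {h : X → ℂ}
    (hh : MemLp h (ENNReal.ofReal q) μ) {K : ℝ≥0∞} (hK : K ≠ ∞)
    (hle : ∀ g : SimpleFunc X ℂ, MemLp g (ENNReal.ofReal p) μ →
      ‖∫ x, h x * g x ∂μ‖ₑ ≤ K * eLpNorm g (ENNReal.ofReal p) μ) :
    eLpNorm h (ENNReal.ofReal q) μ ≤ K := by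
  have hp0 : 0 < p := hpq.pos
  have hq0 : 0 < q := hpq.symm.pos
  have hpe : ENNReal.ofReal p ≠ 0 := by simpa using hp0
  have hqe : ENNReal.ofReal q ≠ 0 := by simpa using hq0
  have := hpq.ennrealOfReal
  have := hpq.symm.ennrealOfReal
  -- By density the estimate holds for all test functions in `L^p`.
  have hle' : ∀ g : X → ℂ, MemLp g (ENNReal.ofReal p) μ →
      ‖∫ x, h x * g x ∂μ‖ₑ ≤ K * eLpNorm g (ENNReal.ofReal p) μ := by
    intro g hg
    obtain ⟨u, hu, hlim, -⟩ := exists_simpleFunc_tendsto_eLpNorm ENNReal.ofReal_ne_top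
      ENNReal.ofReal_ne_top hg hg
    have l1 := (tendsto_integral_mul_of_tendsto_eLpNorm (fun n => (hu n).1) hg hh hlim).enorm
    simp only [mul_comm _ (h _)] at l1
    have l2 : Tendsto (fun n => K * (eLpNorm (⇑(u n) - g) (ENNReal.ofReal p) μ +
        eLpNorm g (ENNReal.ofReal p) μ)) atTop (𝓝 (K * (0 + eLpNorm g (ENNReal.ofReal p) μ))) :=
      ENNReal.Tendsto.const_mul (hlim.add tendsto_const_nhds) (Or.inr hK)
    rw [zero_add] at l2
    refine le_of_tendsto_of_tendsto' l1 l2 fun n => (hle (u n) (hu n).1).trans ?_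
    gcongr
    have h1 : 1 ≤ ENNReal.ofReal p := by simpa using hpq.lt.le
    calc eLpNorm (u n) (ENNReal.ofReal p) μ = eLpNorm ((⇑(u n) - g) + g) (ENNReal.ofReal p) μ := by
          rw [sub_add_cancel]
      _ ≤ _ := eLpNorm_add_le ((hu n).1.sub hg).1 hg.1 h1
  -- The extremal test function.
  set ψ : ℂ → ℂ := fun y => conj y * ((‖y‖ ^ (q - 2) : ℝ) : ℂ) with hψ
  have hψm : Measurable ψ := by
    simp only [hψ]
    fun_prop
  have hψn : ∀ y, ‖ψ y‖ = ‖y‖ ^ (q - 1) := by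
    intro y
    simp only [hψ, norm_mul, RCLike.norm_conj, Complex.norm_real, Real.norm_eq_abs]
    rw [abs_of_nonneg (by positivity)]
    rcases eq_or_ne y 0 with rfl | hy
    · simp [Real.zero_rpow (sub_pos.2 hpq.symm.lt).ne']
    · have : 0 < ‖y‖ := norm_pos_iff.2 hy
      rw [show q - 1 = 1 + (q - 2) by ring, Real.rpow_add this, Real.rpow_one]
  have hψy : ∀ y, y * ψ y = ((‖y‖ ^ q : ℝ) : ℂ) := by
    intro y
    simp only [hψ]
    rw [← mul_assoc, Complex.mul_conj, Complex.normSq_eq_norm_sq, ← Complex.ofReal_mul]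
    congr 1
    rcases eq_or_ne y 0 with rfl | hy
    · simp [Real.zero_rpow hq0.ne']
    · have : 0 < ‖y‖ := norm_pos_iff.2 hy
      rw [← Real.rpow_natCast, ← Real.rpow_add this]
      congr 1
      push_cast
      ring
  have hexp : (q - 1) * p = q := by
    have := hpq.symm.sub_one_mul_conj
    linarith
  have hψp : ∀ y, ‖ψ y‖ ^ p = ‖y‖ ^ q := by
    intro y
    rw [hψn, ← Real.rpow_mul (norm_nonneg _), hexp]
  have hsm : AEStronglyMeasurable (fun x => ψ (h x)) μ :=
    (hψm.comp_aemeasurable hh.1.aemeasurable).aestronglyMeasurable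
  have hI : Integrable (fun x => ‖h x‖ ^ q) μ := by
    have := hh.integrable_norm_rpow hqe ENNReal.ofReal_ne_top
    rwa [ENNReal.toReal_ofReal hq0.le] at this
  have hgp : MemLp (fun x => ψ (h x)) (ENNReal.ofReal p) μ := by
    rw [← integrable_norm_rpow_iff hsm hpe ENNReal.ofReal_ne_top, ENNReal.toReal_ofReal hp0.le]
    simpa only [hψp] using hI
  have key := hle' _ hgp
  set S : ℝ := ∫ x, ‖h x‖ ^ q ∂μ with hS
  have hS0 : 0 ≤ S := integral_nonneg fun x => by positivity
  rw [hgp.eLpNorm_eq_integral_rpow_norm hpe ENNReal.ofReal_ne_top, ENNReal.toReal_ofReal hp0.le]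
    at key
  simp only [hψp, hψy, integral_complex_ofReal] at key
  rw [← hS, ← ofReal_norm, Complex.norm_real, Real.norm_of_nonneg hS0] at key
  rw [hh.eLpNorm_eq_integral_rpow_norm hqe ENNReal.ofReal_ne_top, ENNReal.toReal_ofReal hq0.le,
    ← hS]
  rcases hS0.eq_or_lt with h0 | hpos
  · rw [← h0, Real.zero_rpow (inv_ne_zero hq0.ne')]
    simp
  · have hsplit : S = S ^ q⁻¹ * S ^ p⁻¹ := by
      rw [← Real.rpow_add hpos, add_comm, hpq.inv_add_inv_eq_one, Real.rpow_one]
    have hSp : 0 < S ^ p⁻¹ := by positivity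
    conv_lhs at key => rw [hsplit]
    rw [ENNReal.ofReal_mul (by positivity)] at key
    exact (ENNReal.mul_le_mul_iff_left (by simpa using hSp) ENNReal.ofReal_ne_top).1 key

/-- **Riesz–Thorin** for an operator bounded from `L¹` to `L^∞` and on `L²`. -/
lemma IsL1L2Bounded.eLpNorm_le (hT : IsL1L2Bounded μ T A) (hA : 0 ≤ A) {p q : ℝ}
    (hpq : p.HolderConjugate q) (hp2 : p ≤ 2) {f : X → ℂ} (hf1 : Integrable f μ)
    (hfp : MemLp f (ENNReal.ofReal p) μ) :
    eLpNorm (T f) (ENNReal.ofReal q) μ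
      ≤ ENNReal.ofReal (A ^ (1 - 2 / q)) * eLpNorm f (ENNReal.ofReal p) μ := by
  have hp0 : 0 < p := hpq.pos
  have hq0 : 0 < q := hpq.symm.pos
  have hpe : ENNReal.ofReal p ≠ 0 := by simpa using hp0
  have hqe : ENNReal.ofReal q ≠ 0 := by simpa using hq0
  have hp1 : 1 ≤ ENNReal.ofReal p := by simpa using hpq.lt.le
  have hq2 : 2 ≤ q := by
    have h1 := hpq.inv_add_inv_eq_one
    have h2 : 2⁻¹ ≤ p⁻¹ := inv_anti₀ hp0 hp2
    have h3 : q⁻¹ ≤ 2⁻¹ := by linarith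
    exact (inv_le_inv₀ hq0 two_pos).1 h3
  have hsimple : ∀ u : SimpleFunc X ℂ, Integrable u μ →
      eLpNorm (T u) (ENNReal.ofReal q) μ
        ≤ ENNReal.ofReal (A ^ (1 - 2 / q)) * eLpNorm u (ENNReal.ofReal p) μ := by
    intro u hu
    have hup : MemLp u (ENNReal.ofReal p) μ :=
      (SimpleFunc.memLp_iff_integrable hpe ENNReal.ofReal_ne_top).2 hu
    have hu2 : MemLp u 2 μ := (SimpleFunc.memLp_iff_integrable (by norm_num) (by norm_num)).2 hu
    -- `T u` is bounded and square integrable, hence in `L^q`.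
    have hTq : MemLp (T u) (ENNReal.ofReal q) μ := by
      have hT2 := hT.memLp_two hu hu2
      rw [← integrable_norm_rpow_iff hT2.1 hqe ENNReal.ofReal_ne_top,
        ENNReal.toReal_ofReal hq0.le]
      have hsq := hT2.integrable_norm_rpow (by norm_num) (by norm_num)
      set B := A * ∫ x, ‖u x‖ ∂μ with hB
      refine (hsq.const_mul (B ^ (q - 2))).mono'
        (hT2.1.norm.aemeasurable.pow_const q).aestronglyMeasurable (ae_of_all _ fun x => ?_)
      have hx := hT.norm_le u hu x
      rw [Real.norm_of_nonneg (by positivity), ENNReal.toReal_ofNat]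
      calc ‖T u x‖ ^ q = ‖T u x‖ ^ (q - 2) * ‖T u x‖ ^ (2 : ℝ) := by
            rw [← Real.rpow_add_of_nonneg (norm_nonneg _) (by linarith) (by norm_num),
              sub_add_cancel]
        _ ≤ B ^ (q - 2) * ‖T u x‖ ^ (2 : ℝ) := by
            gcongr
    refine eLpNorm_le_of_forall_simpleFunc hpq hTq (ENNReal.mul_ne_top ENNReal.ofReal_ne_top
      hup.2.ne) fun g hgp => ?_
    have hg : Integrable g μ := (SimpleFunc.memLp_iff_integrable hpe ENNReal.ofReal_ne_top).1 hgp
    have h := hT.norm_integral_mul_le_interp hA hpq hp2 u g hu hg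
    rw [hup.eLpNorm_eq_integral_rpow_norm hpe ENNReal.ofReal_ne_top,
      hgp.eLpNorm_eq_integral_rpow_norm hpe ENNReal.ofReal_ne_top, ENNReal.toReal_ofReal hp0.le,
      ← ENNReal.ofReal_mul (by positivity), ← ENNReal.ofReal_mul (by positivity),
      ← ofReal_norm, ← one_div]
    exact ENNReal.ofReal_le_ofReal h
  -- Simple functions `uₙ → f` in `L¹ ∩ L^p` give `T uₙ → T f` pointwise; apply Fatou's lemma.
  obtain ⟨u, hu, hlim1, hlimp⟩ := exists_simpleFunc_tendsto_eLpNorm ENNReal.one_ne_top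
    ENNReal.ofReal_ne_top (memLp_one_iff_integrable.2 hf1) hfp
  have hu1 : ∀ n, Integrable (u n) μ := fun n => memLp_one_iff_integrable.1 (hu n).1
  have hpt : ∀ x, Tendsto (fun n => T (u n) x) atTop (𝓝 (T f x)) := by
    intro x
    rw [tendsto_iff_norm_sub_tendsto_zero]
    have hl : Tendsto (fun n => A * ∫ x, ‖(⇑(u n) - f) x‖ ∂μ) atTop (𝓝 0) := by
      have := (ENNReal.tendsto_toReal ENNReal.zero_ne_top).comp hlim1
      simp only [Function.comp_def, eLpNorm_one_eq_lintegral_enorm, ENNReal.toReal_zero] at this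
      simp only [integral_norm_eq_lintegral_enorm ((hu1 _).sub hf1).1]
      simpa using this.const_mul A
    refine squeeze_zero (fun _ => norm_nonneg _) (fun n => ?_) hl
    have := hT.norm_le _ ((hu1 n).sub hf1) x
    rwa [hT.sub (hu1 n) hf1] at this
  refine (Lp.eLpNorm_lim_le_liminf_eLpNorm (fun n => hT.aestronglyMeasurable _ (hu1 n)) _
    (ae_of_all _ hpt)).trans ?_
  have hlim : Tendsto (fun n => ENNReal.ofReal (A ^ (1 - 2 / q)) *
      (eLpNorm (⇑(u n) - f) (ENNReal.ofReal p) μ + eLpNorm f (ENNReal.ofReal p) μ)) atTop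
      (𝓝 (ENNReal.ofReal (A ^ (1 - 2 / q)) * (0 + eLpNorm f (ENNReal.ofReal p) μ))) :=
    ENNReal.Tendsto.const_mul (hlimp.add tendsto_const_nhds) (Or.inr ENNReal.ofReal_ne_top)
  rw [zero_add] at hlim
  rw [← hlim.liminf_eq]
  refine liminf_le_liminf (Eventually.of_forall fun n => (hsimple (u n) (hu1 n)).trans ?_)
  gcongr
  calc eLpNorm (u n) (ENNReal.ofReal p) μ = eLpNorm ((⇑(u n) - f) + f) (ENNReal.ofReal p) μ := by
        rw [sub_add_cancel]
    _ ≤ _ := eLpNorm_add_le ((hu n).2.sub hfp).1 hfp.1 hp1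

end RieszThorin

/-! ### The linear canonical Dunkl transform -/

/-- The chirp `exp((i/2) r x²)`. -/
noncomputable def chirp (r x : ℝ) : ℂ := Complex.exp (((r * x ^ 2 / 2 : ℝ) : ℂ) * Complex.I)

lemma norm_chirp (r x : ℝ) : ‖chirp r x‖ = 1 := Complex.norm_exp_ofReal_mul_I _

lemma continuous_chirp (r : ℝ) : Continuous (chirp r) := by
  unfold chirp
  fun_prop

section LCDT

variable {k : ℝ} {M : Matrix.SpecialLinearGroup (Fin 2) ℝ}

lemma MeasureTheory.MemLp.mul_chirp {p : ℝ≥0∞} {μ : Measure ℝ} {f : ℝ → ℂ} (hf : MemLp f p μ)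
    (r : ℝ) : MemLp (fun x => f x * chirp r x) p μ :=
  hf.of_le (hf.1.mul (continuous_chirp r).aestronglyMeasurable)
    (ae_of_all _ fun x => by rw [norm_mul, norm_chirp, mul_one])

lemma eLpNorm_mul_chirp (f : ℝ → ℂ) (r : ℝ) (p : ℝ≥0∞) (μ : Measure ℝ) :
    eLpNorm (fun x => f x * chirp r x) p μ = eLpNorm f p μ :=
  eLpNorm_congr_norm_ae (ae_of_all _ fun x => by rw [norm_mul, norm_chirp, mul_one])

/-- For `b ≠ 0` the linear canonical Dunkl transform is the Dunkl transform between two chirp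
multiplications, followed by a dilation. -/
lemma lcdt_eq (hb : M 0 1 ≠ 0) (f : ℝ → ℂ) (ξ : ℝ) :
    lcdt k M f ξ = 1 / (Complex.I * ((M 0 1 : ℝ) : ℂ)) ^ ((k : ℂ) + 1) *
      (chirp (M 1 1 / M 0 1) ξ *
        dunklTransform k (fun x => f x * chirp (M 0 0 / M 0 1) x) (ξ / M 0 1)) := by
  rw [lcdt, if_neg hb, dunklTransform, ← integral_const_mul (chirp (M 1 1 / M 0 1) ξ)]
  congr 1
  refine integral_congr_ae (ae_of_all _ fun x => ?_)
  simp only [lcdtKernel, chirp]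
  have h : Complex.exp (Complex.I / 2 *
      (((M 1 1 / M 0 1 * ξ ^ 2 + M 0 0 / M 0 1 * x ^ 2 : ℝ)) : ℂ))
      = Complex.exp (((M 1 1 / M 0 1 * ξ ^ 2 / 2 : ℝ) : ℂ) * Complex.I) *
        Complex.exp (((M 0 0 / M 0 1 * x ^ 2 / 2 : ℝ) : ℂ) * Complex.I) := by
    rw [← Complex.exp_add]
    congr 1
    push_cast
    ring
  rw [h]
  ring

lemma norm_lcdt (hb : M 0 1 ≠ 0) (f : ℝ → ℂ) (ξ : ℝ) :
    ‖lcdt k M f ξ‖ = 1 / |M 0 1| ^ (k + 1) *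
      ‖dunklTransform k (fun x => f x * chirp (M 0 0 / M 0 1) x) (ξ / M 0 1)‖ := by
  have hne : Complex.I * ((M 0 1 : ℝ) : ℂ) ≠ 0 :=
    mul_ne_zero Complex.I_ne_zero (by exact_mod_cast hb)
  have hpow : ‖(Complex.I * ((M 0 1 : ℝ) : ℂ)) ^ ((k : ℂ) + 1)‖ = |M 0 1| ^ (k + 1) := by
    rw [Complex.norm_cpow_of_ne_zero hne]
    simp
  rw [lcdt_eq hb, norm_mul, norm_mul, norm_div, norm_one, hpow, norm_chirp, one_mul]

lemma continuous_lcdt (hk : -(1 / 2) ≤ k) (hb : M 0 1 ≠ 0) {f : ℝ → ℂ}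
    (hf : Integrable f (dunklMeasure k)) : Continuous (lcdt k M f) := by
  have hf' : Integrable (fun x => f x * chirp (M 0 0 / M 0 1) x) (dunklMeasure k) :=
    memLp_one_iff_integrable.1 ((memLp_one_iff_integrable.2 hf).mul_chirp _)
  have h1 := continuous_dunklTransform hk hf'
  have h2 := continuous_chirp (M 1 1 / M 0 1)
  have h3 : lcdt k M f = fun ξ => 1 / (Complex.I * ((M 0 1 : ℝ) : ℂ)) ^ ((k : ℂ) + 1) *
      (chirp (M 1 1 / M 0 1) ξ *
        dunklTransform k (fun x => f x * chirp (M 0 0 / M 0 1) x) (ξ / M 0 1)) :=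
    funext (lcdt_eq hb f)
  rw [h3]
  exact continuous_const.mul (h2.mul (h1.comp (continuous_id.div_const _)))

lemma eLpNorm_two_comp_div (hb : M 0 1 ≠ 0) {g : ℝ → ℂ} (hg : Continuous g) :
    ENNReal.ofReal (1 / |M 0 1| ^ (k + 1)) *
      eLpNorm (fun ξ => g (ξ / M 0 1)) 2 (dunklMeasure k) = eLpNorm g 2 (dunklMeasure k) := by
  have hb' : 0 < |M 0 1| := abs_pos.2 hb
  have h := eLpNorm_map_measure (p := 2) (μ := dunklMeasure k) (f := fun x => (M 0 1)⁻¹ * x) (g := g)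
    hg.aestronglyMeasurable (measurable_const_mul _).aemeasurable
  rw [map_mul_left_dunklMeasure k (inv_ne_zero hb),
    eLpNorm_smul_measure_of_ne_top (by norm_num)] at h
  have hcomp : (g ∘ fun x => (M 0 1)⁻¹ * x) = fun ξ => g (ξ / M 0 1) := by
    funext ξ
    simp [div_eq_inv_mul]
  rw [hcomp] at h
  rw [← h, smul_eq_mul, ← mul_assoc, abs_inv, ENNReal.ofReal_rpow_of_nonneg (by positivity)
    ENNReal.toReal_nonneg, ← ENNReal.ofReal_mul (by positivity)]
  have h1 : 1 / |M 0 1| ^ (k + 1) * (|M 0 1|⁻¹ ^ (-(2 * k + 2))) ^ (1 / (2 : ℝ≥0∞)).toReal = 1 := by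
    rw [Real.inv_rpow hb'.le, Real.rpow_neg hb'.le, inv_inv, ← Real.rpow_mul hb'.le]
    simp only [one_div, ENNReal.toReal_inv, ENNReal.toReal_ofNat]
    rw [show (2 * k + 2) * 2⁻¹ = k + 1 by ring]
    have : 0 < |M 0 1| ^ (k + 1) := by positivity
    exact inv_mul_cancel₀ this.ne'
  rw [h1, ENNReal.ofReal_one, one_mul]

lemma isL1L2Bounded_lcdt (hk : -(1 / 2) ≤ k) (hb : M 0 1 ≠ 0) :
    IsL1L2Bounded (dunklMeasure k) (lcdt k M) (1 / |M 0 1| ^ (k + 1)) := by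
  set r := M 0 0 / M 0 1 with hr
  have hchirp : ∀ f : ℝ → ℂ, Integrable f (dunklMeasure k) →
      Integrable (fun x => f x * chirp r x) (dunklMeasure k) := fun f hf =>
    memLp_one_iff_integrable.1 ((memLp_one_iff_integrable.2 hf).mul_chirp _)
  refine ⟨fun f g hf hg => ?_, fun c f => ?_, fun f hf =>
    (continuous_lcdt hk hb hf).aestronglyMeasurable, fun f hf ξ => ?_, fun f hf hf2 => ?_⟩
  · funext ξ
    have h : (fun x => (f + g) x * chirp r x)
        = (fun x => f x * chirp r x) + fun x => g x * chirp r x := by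
      funext x
      simp [add_mul]
    rw [Pi.add_apply, lcdt_eq hb, lcdt_eq hb, lcdt_eq hb, h,
      dunklTransform_add hk (hchirp f hf) (hchirp g hg), Pi.add_apply]
    ring
  · funext ξ
    have h : (fun x => (c • f) x * chirp r x) = c • fun x => f x * chirp r x := by
      funext x
      simp [mul_assoc]
    rw [Pi.smul_apply, lcdt_eq hb, lcdt_eq hb, h, dunklTransform_smul, Pi.smul_apply, smul_eq_mul,
      smul_eq_mul]
    ring
  · rw [norm_lcdt hb]
    refine mul_le_mul_of_nonneg_left ?_ (by positivity)
    refine (norm_dunklTransform_le hk (hchirp f hf) _).trans (le_of_eq ?_)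
    simp only [norm_mul, norm_chirp, mul_one]
  · have hle := eLpNorm_two_dunklTransform_le hk (hchirp f hf) (hf2.mul_chirp r)
    rw [eLpNorm_mul_chirp] at hle
    refine le_trans (le_of_eq ?_) hle
    rw [← eLpNorm_two_comp_div hb (continuous_dunklTransform hk (hchirp f hf))]
    have hconst : ENNReal.ofReal (1 / |M 0 1| ^ (k + 1))
        = ‖((1 / |M 0 1| ^ (k + 1) : ℝ) : ℂ)‖ₑ := by
      rw [← ofReal_norm, Complex.norm_real, Real.norm_of_nonneg (by positivity)]
    rw [hconst, ← eLpNorm_const_smul]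
    refine eLpNorm_congr_norm_ae (ae_of_all _ fun ξ => ?_)
    rw [norm_lcdt hb, Pi.smul_apply, norm_smul, Complex.norm_real,
      Real.norm_of_nonneg (by positivity)]

/-- The Hausdorff–Young inequality on `L¹ ∩ L^p`. -/
lemma eLpNorm_lcdt_le (hk : -(1 / 2) ≤ k) (hb : M 0 1 ≠ 0) {p q : ℝ} (hpq : p.HolderConjugate q)
    (hp2 : p ≤ 2) {f : ℝ → ℂ} (hf1 : Integrable f (dunklMeasure k))
    (hfp : MemLp f (ENNReal.ofReal p) (dunklMeasure k)) :
    eLpNorm (lcdt k M f) (ENNReal.ofReal q) (dunklMeasure k)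
      ≤ ENNReal.ofReal ((1 / |M 0 1| ^ (k + 1)) ^ (1 - 2 / q)) *
        eLpNorm f (ENNReal.ofReal p) (dunklMeasure k) :=
  (isL1L2Bounded_lcdt hk hb).eLpNorm_le (by positivity) hpq hp2 hf1 hfp

lemma eLpNorm_lcdt_sub_le (hk : -(1 / 2) ≤ k) (hb : M 0 1 ≠ 0) {p q : ℝ}
    (hpq : p.HolderConjugate q) (hp2 : p ≤ 2) {f g : ℝ → ℂ} (hf1 : Integrable f (dunklMeasure k))
    (hfp : MemLp f (ENNReal.ofReal p) (dunklMeasure k)) (hg1 : Integrable g (dunklMeasure k))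
    (hgp : MemLp g (ENNReal.ofReal p) (dunklMeasure k)) :
    eLpNorm (lcdt k M f - lcdt k M g) (ENNReal.ofReal q) (dunklMeasure k)
      ≤ ENNReal.ofReal ((1 / |M 0 1| ^ (k + 1)) ^ (1 - 2 / q)) *
        eLpNorm (f - g) (ENNReal.ofReal p) (dunklMeasure k) := by
  rw [← (isL1L2Bounded_lcdt hk hb).sub hf1 hg1]
  exact eLpNorm_lcdt_le hk hb hpq hp2 (hf1.sub hg1) (hfp.sub hgp)

/-! ### The extension to `L^p` -/

lemma ae_eq_of_isLpLCDT (hk : -(1 / 2) ≤ k) (hb : M 0 1 ≠ 0) {p q : ℝ}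
    (hpq : p.HolderConjugate q) (hp2 : p ≤ 2) {f g h : ℝ → ℂ}
    (hg : IsLpLCDT k M p q f g) (hh : IsLpLCDT k M p q f h) : h =ᵐ[dunklMeasure k] g := by
  obtain ⟨hf, hgq, u, hu, hulim, hug⟩ := hg
  obtain ⟨-, hhq, v, hv, hvlim, hvh⟩ := hh
  have hq0 : 0 < q := hpq.symm.pos
  have hp1 : 1 ≤ ENNReal.ofReal p := by simpa using hpq.lt.le
  have hq1 : 1 ≤ ENNReal.ofReal q := by simpa using hpq.symm.lt.le
  set C := ENNReal.ofReal ((1 / |M 0 1| ^ (k + 1)) ^ (1 - 2 / q)) with hC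
  have hm : ∀ w : ℝ → ℂ, Integrable w (dunklMeasure k) →
      AEStronglyMeasurable (lcdt k M w) (dunklMeasure k) := fun w hw =>
    (continuous_lcdt hk hb hw).aestronglyMeasurable
  have hle : ∀ n, eLpNorm (h - g) (ENNReal.ofReal q) (dunklMeasure k) ≤
      eLpNorm (fun ξ => lcdt k M (v n) ξ - h ξ) (ENNReal.ofReal q) (dunklMeasure k) +
      (C * (eLpNorm (fun x => v n x - f x) (ENNReal.ofReal p) (dunklMeasure k) +
        eLpNorm (fun x => u n x - f x) (ENNReal.ofReal p) (dunklMeasure k)) +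
      eLpNorm (fun ξ => lcdt k M (u n) ξ - g ξ) (ENNReal.ofReal q) (dunklMeasure k)) := by
    intro n
    have hmv := hm _ (hv n).1
    have hmu := hm _ (hu n).1
    have e1 : h - g = (lcdt k M (u n) - g) + (lcdt k M (v n) - lcdt k M (u n)) -
        (lcdt k M (v n) - h) := by abel
    have e2 : v n - u n = (v n - f) - (u n - f) := by abel
    have h1 : eLpNorm (lcdt k M (v n) - lcdt k M (u n)) (ENNReal.ofReal q) (dunklMeasure k)
        ≤ C * (eLpNorm (v n - f) (ENNReal.ofReal p) (dunklMeasure k) +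
          eLpNorm (u n - f) (ENNReal.ofReal p) (dunklMeasure k)) := by
      refine (eLpNorm_lcdt_sub_le hk hb hpq hp2 (hv n).1 (hv n).2 (hu n).1 (hu n).2).trans ?_
      gcongr
      rw [e2]
      exact eLpNorm_sub_le ((hv n).2.sub hf).1 ((hu n).2.sub hf).1 hp1
    rw [e1]
    refine (eLpNorm_sub_le ((hmu.sub hgq.1).add (hmv.sub hmu)) (hmv.sub hhq.1) hq1).trans ?_
    rw [add_comm]
    refine add_le_add le_rfl ((eLpNorm_add_le (hmu.sub hgq.1) (hmv.sub hmu) hq1).trans ?_)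
    rw [add_comm]
    exact add_le_add h1 le_rfl
  have hlim := hvh.add ((ENNReal.Tendsto.const_mul (a := C) (hvlim.add hulim)
    (Or.inr ENNReal.ofReal_ne_top)).add hug)
  simp only [add_zero, mul_zero] at hlim
  have h0 : eLpNorm (h - g) (ENNReal.ofReal q) (dunklMeasure k) = 0 :=
    le_antisymm (ge_of_tendsto' hlim hle) zero_le
  rw [eLpNorm_eq_zero_iff (hhq.1.sub hgq.1) (by simpa using hq0)] at h0
  filter_upwards [h0] with x hx
  exact sub_eq_zero.1 hx

/-- The simple functions approximating `f` in both spaces at once give a common image `g`, and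
Hausdorff–Young passes to the limit. -/
lemma exists_isLpLCDT (hk : -(1 / 2) ≤ k) (hb : M 0 1 ≠ 0) {p₁ p₂ q₁ q₂ : ℝ}
    (hq₁ : p₁.HolderConjugate q₁) (hq₂ : p₂.HolderConjugate q₂) (hp₁ : p₁ ≤ 2) (hp₂ : p₂ ≤ 2)
    {f : ℝ → ℂ} (hf₁ : MemLp f (ENNReal.ofReal p₁) (dunklMeasure k))
    (hf₂ : MemLp f (ENNReal.ofReal p₂) (dunklMeasure k)) :
    ∃ g : ℝ → ℂ, IsLpLCDT k M p₁ q₁ f g ∧ IsLpLCDT k M p₂ q₂ f g ∧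
      eLpNorm g (ENNReal.ofReal q₁) (dunklMeasure k)
        ≤ ENNReal.ofReal ((1 / |M 0 1| ^ (k + 1)) ^ (1 - 2 / q₁)) *
          eLpNorm f (ENNReal.ofReal p₁) (dunklMeasure k) := by
  obtain ⟨u, hu, hlim₁, hlim₂⟩ := exists_simpleFunc_tendsto_eLpNorm ENNReal.ofReal_ne_top
    ENNReal.ofReal_ne_top hf₁ hf₂
  have hu1 : ∀ n, Integrable (u n) (dunklMeasure k) := fun n =>
    (SimpleFunc.memLp_iff_integrable (by simpa using hq₁.pos) ENNReal.ofReal_ne_top).1 (hu n).1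
  have hm : ∀ n, AEStronglyMeasurable (lcdt k M (u n)) (dunklMeasure k) := fun n =>
    (continuous_lcdt hk hb (hu1 n)).aestronglyMeasurable
  have hex : ∀ {p q : ℝ}, p.HolderConjugate q → p ≤ 2 →
      MemLp f (ENNReal.ofReal p) (dunklMeasure k) →
      (∀ n, MemLp (u n) (ENNReal.ofReal p) (dunklMeasure k)) →
      Tendsto (fun n => eLpNorm (⇑(u n) - f) (ENNReal.ofReal p) (dunklMeasure k)) atTop (𝓝 0) →
      ∃ g, MemLp g (ENNReal.ofReal q) (dunklMeasure k) ∧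
        Tendsto (fun n => eLpNorm (lcdt k M (u n) - g) (ENNReal.ofReal q) (dunklMeasure k))
          atTop (𝓝 0) := by
    intro p q hpq hp2 hf hup hlim
    refine exists_tendsto_eLpNorm_of_le (by simpa using hpq.lt.le) (by simpa using hpq.symm.lt.le)
      ENNReal.ofReal_ne_top hup hf (fun n => ⟨hm n, ?_⟩)
      (fun n m => eLpNorm_lcdt_sub_le hk hb hpq hp2 (hu1 n) (hup n) (hu1 m) (hup m)) hlim
    exact (eLpNorm_lcdt_le hk hb hpq hp2 (hu1 n) (hup n)).trans_lt
      (ENNReal.mul_lt_top ENNReal.ofReal_lt_top (hup n).2)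
  obtain ⟨g, hg, hglim⟩ := hex hq₁ hp₁ hf₁ (fun n => (hu n).1) hlim₁
  obtain ⟨g', hg', hglim'⟩ := hex hq₂ hp₂ hf₂ (fun n => (hu n).2) hlim₂
  have hgg' : g' =ᵐ[dunklMeasure k] g :=
    tendstoInMeasure_ae_unique
      (tendstoInMeasure_of_tendsto_eLpNorm (by simpa using hq₂.symm.pos) hm hg'.1 hglim')
      (tendstoInMeasure_of_tendsto_eLpNorm (by simpa using hq₁.symm.pos) hm hg.1 hglim)
  have hglim₂ : Tendsto (fun n => eLpNorm (lcdt k M (u n) - g) (ENNReal.ofReal q₂)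
      (dunklMeasure k)) atTop (𝓝 0) :=
    hglim'.congr fun n => eLpNorm_congr_ae ((ae_eq_refl _).sub hgg')
  refine ⟨g, ⟨hf₁, hg, fun n => u n, fun n => ⟨hu1 n, (hu n).1⟩, hlim₁, hglim⟩,
    ⟨hf₂, hg'.ae_eq hgg', fun n => u n, fun n => ⟨hu1 n, (hu n).2⟩, hlim₂, hglim₂⟩, ?_⟩
  set C := ENNReal.ofReal ((1 / |M 0 1| ^ (k + 1)) ^ (1 - 2 / q₁)) with hC
  have hlim := hglim.add (ENNReal.Tendsto.const_mul (a := C)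
    (hlim₁.add (tendsto_const_nhds (x := eLpNorm f (ENNReal.ofReal p₁) (dunklMeasure k))))
    (Or.inr ENNReal.ofReal_ne_top))
  rw [zero_add, zero_add] at hlim
  refine ge_of_tendsto' hlim fun n => ?_
  calc eLpNorm g (ENNReal.ofReal q₁) (dunklMeasure k)
      = eLpNorm (lcdt k M (u n) - (lcdt k M (u n) - g)) (ENNReal.ofReal q₁) (dunklMeasure k) := by
        rw [sub_sub_cancel]
    _ ≤ eLpNorm (lcdt k M (u n)) (ENNReal.ofReal q₁) (dunklMeasure k) +
        eLpNorm (lcdt k M (u n) - g) (ENNReal.ofReal q₁) (dunklMeasure k) :=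
      eLpNorm_sub_le (hm n) ((hm n).sub hg.1) (by simpa using hq₁.symm.lt.le)
    _ ≤ eLpNorm (lcdt k M (u n) - g) (ENNReal.ofReal q₁) (dunklMeasure k) +
        C * eLpNorm (⇑(u n)) (ENNReal.ofReal p₁) (dunklMeasure k) := by
      rw [add_comm]
      exact add_le_add le_rfl (eLpNorm_lcdt_le hk hb hq₁ hp₁ (hu1 n) (hu n).1)
    _ = eLpNorm (lcdt k M (u n) - g) (ENNReal.ofReal q₁) (dunklMeasure k) +
        C * eLpNorm ((⇑(u n) - f) + f) (ENNReal.ofReal p₁) (dunklMeasure k) := by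
      rw [sub_add_cancel]
    _ ≤ _ := by
      gcongr
      exact eLpNorm_add_le ((hu n).1.sub hf₁).1 hf₁.1 (by simpa using hq₁.lt.le)

end LCDT

/-! ### The Nash inequality by splitting at a radius -/

/-- Optimization over the splitting radius; the choice `r = (B / N)^{q / (α + β)}` makes
`N^q r^α` and `r^{-β} B^q` equal. -/
lemma le_of_forall_radius_le {X N B K q α β : ℝ} (hX : 0 ≤ X) (hN : 0 < N) (hB : 0 < B)
    (hK : 0 ≤ K) (hq : 0 < q) (hα : 0 < α) (hβ : 0 < β)
    (h : ∀ r : ℝ, 0 < r → X ^ q ≤ K * N ^ q * r ^ α + r ^ (-β) * B ^ q) :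
    X ≤ (1 + K) ^ (1 / q) * N ^ (β / (α + β)) * B ^ (α / (α + β)) := by
  have hαβ : 0 < α + β := add_pos hα hβ
  have hexp : ∀ γ : ℝ, ((B / N) ^ (q / (α + β))) ^ γ
      = B ^ (q * γ / (α + β)) * N ^ (-(q * γ / (α + β))) := by
    intro γ
    rw [← Real.rpow_mul (by positivity), Real.div_rpow hB.le hN.le, Real.rpow_neg hN.le,
      div_eq_mul_inv, show q / (α + β) * γ = q * γ / (α + β) by ring]
  have hr := h ((B / N) ^ (q / (α + β))) (by positivity)
  rw [hexp, hexp] at hr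
  have e1 : N ^ q * (B ^ (q * α / (α + β)) * N ^ (-(q * α / (α + β))))
      = (N ^ (β / (α + β)) * B ^ (α / (α + β))) ^ q := by
    rw [Real.mul_rpow (by positivity) (by positivity), ← Real.rpow_mul hN.le, ← Real.rpow_mul hB.le,
      mul_left_comm, ← Real.rpow_add hN, mul_comm (N ^ _), show α / (α + β) * q = q * α / (α + β) by ring]
    congr 2
    field_simp
    ring
  have e2 : B ^ (q * -β / (α + β)) * N ^ (-(q * -β / (α + β))) * B ^ q
      = (N ^ (β / (α + β)) * B ^ (α / (α + β))) ^ q := by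
    rw [Real.mul_rpow (by positivity) (by positivity), ← Real.rpow_mul hN.le, ← Real.rpow_mul hB.le,
      mul_right_comm, ← Real.rpow_add hB, mul_comm (B ^ _)]
    congr 2
    · field_simp
    · field_simp
      ring
  rw [mul_assoc, e1, e2] at hr
  have hr' : X ^ q ≤ ((1 + K) ^ (1 / q) * N ^ (β / (α + β)) * B ^ (α / (α + β))) ^ q := by
    rw [mul_assoc, Real.mul_rpow (by positivity) (by positivity), ← Real.rpow_mul (by positivity),
      one_div_mul_cancel hq.ne', Real.rpow_one]
    linarith
  exact (Real.rpow_le_rpow_iff hX (by positivity) hq).1 hr'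

lemma eLpNorm_rpow_eq_add_compl {X : Type*} [MeasurableSpace X] {μ : Measure X} {q : ℝ} (hq : 0 < q)
    (g : X → ℂ) {S : Set X} (hS : MeasurableSet S) :
    eLpNorm g (ENNReal.ofReal q) μ ^ q = eLpNorm g (ENNReal.ofReal q) (μ.restrict S) ^ q +
      eLpNorm g (ENNReal.ofReal q) (μ.restrict Sᶜ) ^ q := by
  have h : ∀ ν : Measure X, eLpNorm g (ENNReal.ofReal q) ν ^ q = ∫⁻ x, ‖g x‖ₑ ^ q ∂ν := by
    intro ν
    rw [eLpNorm_eq_lintegral_rpow_enorm_toReal (by simpa using hq) ENNReal.ofReal_ne_top,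
      ENNReal.toReal_ofReal hq.le, ← ENNReal.rpow_mul, one_div_mul_cancel hq.ne', ENNReal.rpow_one]
  rw [h, h, h, lintegral_add_compl _ hS]

/-- Inside radius `r` Hölder's inequality compares the two norms; outside, the weight is at least
`r^s`. -/
lemma eLpNorm_rpow_le_radius {k : ℝ} (hk : -(1 / 2) ≤ k) {q₁ q₂ s r : ℝ} (hq₂ : 0 < q₂)
    (hq : q₂ ≤ q₁) (hs : 0 < s) (hr : 0 < r) {g : ℝ → ℂ}
    (hg : AEStronglyMeasurable g (dunklMeasure k)) :
    eLpNorm g (ENNReal.ofReal q₂) (dunklMeasure k) ^ q₂ ≤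
      (eLpNorm g (ENNReal.ofReal q₁) (dunklMeasure k) *
        ENNReal.ofReal (r ^ (2 * k + 2) / ((2 : ℝ) ^ (k + 1) * Real.Gamma (k + 2))) ^
          (1 / q₂ - 1 / q₁)) ^ q₂ +
      (ENNReal.ofReal (r ^ (-s)) * eLpNorm (fun x => ((|x| ^ s : ℝ) : ℂ) * g x)
        (ENNReal.ofReal q₂) (dunklMeasure k)) ^ q₂ := by
  have hq₁ : 0 < q₁ := hq₂.trans_le hq
  rw [eLpNorm_rpow_eq_add_compl hq₂ g (measurableSet_Icc (a := -r) (b := r))]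
  refine add_le_add (ENNReal.rpow_le_rpow ?_ hq₂.le) (ENNReal.rpow_le_rpow ?_ hq₂.le)
  · have h := eLpNorm_le_eLpNorm_mul_rpow_measure_univ (ENNReal.ofReal_le_ofReal hq)
      (hg.restrict (s := Icc (-r) r))
    rw [Measure.restrict_apply_univ, dunklMeasure_Icc hk hr, ENNReal.toReal_ofReal hq₂.le,
      ENNReal.toReal_ofReal hq₁.le] at h
    refine h.trans ?_
    gcongr
    exact Measure.restrict_le_self
  · have hconst : ENNReal.ofReal (r ^ (-s)) = ‖((r ^ (-s) : ℝ) : ℂ)‖ₑ := by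
      rw [← ofReal_norm, Complex.norm_real, Real.norm_of_nonneg (by positivity)]
    rw [hconst, ← eLpNorm_const_smul]
    refine le_trans (eLpNorm_mono_ae ?_) (eLpNorm_mono_measure _ Measure.restrict_le_self)
    filter_upwards [ae_restrict_mem (measurableSet_Icc (a := -r) (b := r)).compl] with x hx
    have hx' : r ≤ |x| := by
      rw [mem_compl_iff, mem_Icc, ← abs_le, not_le] at hx
      exact hx.le
    have hpow : r ^ s ≤ |x| ^ s := Real.rpow_le_rpow hr.le hx' hs.le
    rw [Pi.smul_apply, norm_smul, norm_mul, Complex.norm_real, Complex.norm_real,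
      Real.norm_of_nonneg (by positivity), Real.norm_of_nonneg (by positivity), ← mul_assoc]
    refine le_mul_of_one_le_left (norm_nonneg _) ?_
    rw [Real.rpow_neg hr.le]
    have : 0 < r ^ s := by positivity
    rwa [← div_eq_inv_mul, one_le_div this]

theorem theoremt (k : ℝ) (hk : -(1 / 2) ≤ k)
    (M : Matrix.SpecialLinearGroup (Fin 2) ℝ) (hb : M 0 1 ≠ 0)
    (p₁ p₂ q₁ q₂ : ℝ) (hp₁ : 1 < p₁) (hp₁₂ : p₁ < p₂) (hp₂ : p₂ ≤ 2)
    (hq₁ : p₁.HolderConjugate q₁) (hq₂ : p₂.HolderConjugate q₂)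
    (f : ℝ → ℂ)
    (hf₁ : MeasureTheory.MemLp f (ENNReal.ofReal p₁) (dunklMeasure k))
    (hf₂ : MeasureTheory.MemLp f (ENNReal.ofReal p₂) (dunklMeasure k)) :
    ∃ g : ℝ → ℂ,
      -- `g` is the transform of `f`, both as an element of `L^{p₁}` and of `L^{p₂}`,
      (IsLpLCDT k M p₁ q₁ f g ∧ IsLpLCDT k M p₂ q₂ f g) ∧
      -- it is unique up to null sets,
      (∀ h : ℝ → ℂ, IsLpLCDT k M p₁ q₁ f h ∨ IsLpLCDT k M p₂ q₂ f h →
        h =ᵐ[dunklMeasure k] g) ∧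
      -- and it satisfies the inequality for every weight exponent `s > 0`.
      ∀ s : ℝ, 0 < s →
        MeasureTheory.eLpNorm g (ENNReal.ofReal q₂) (dunklMeasure k) ≤
          ENNReal.ofReal (nashConst q₁ q₂ k (M 0 1)) *
            MeasureTheory.eLpNorm f (ENNReal.ofReal p₁) (dunklMeasure k) ^
              (s * q₁ * q₂ / ((2 * k + 2) * (q₁ - q₂) + s * q₁ * q₂)) *
            MeasureTheory.eLpNorm (fun x => ((|x| ^ s : ℝ) : ℂ) * g x)
                (ENNReal.ofReal q₂) (dunklMeasure k) ^
              ((2 * k + 2) * (q₁ - q₂) / ((2 * k + 2) * (q₁ - q₂) + s * q₁ * q₂)) := by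
  have hp₁2 : p₁ ≤ 2 := hp₁₂.le.trans hp₂
  obtain ⟨g, hg₁, hg₂, hHY⟩ := exists_isLpLCDT hk hb hq₁ hq₂ hp₁2 hp₂ hf₁ hf₂
  refine ⟨g, ⟨hg₁, hg₂⟩, fun h hh => ?_, fun s hs => ?_⟩
  · rcases hh with hh | hh
    · exact ae_eq_of_isLpLCDT hk hb hq₁ hp₁2 hg₁ hh
    · exact ae_eq_of_isLpLCDT hk hb hq₂ hp₂ hg₂ hh
  have hq₁0 : 0 < q₁ := hq₁.symm.pos
  have hq₂0 : 0 < q₂ := hq₂.symm.pos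
  have hq : q₂ < q₁ := by
    have h1 := hq₁.inv_add_inv_eq_one
    have h2 := hq₂.inv_add_inv_eq_one
    have h3 : p₂⁻¹ < p₁⁻¹ := (inv_lt_inv₀ hq₂.pos hq₁.pos).2 hp₁₂
    exact (inv_lt_inv₀ hq₁0 hq₂0).1 (by linarith)
  have hk2 : 0 < 2 * k + 2 := by linarith
  have hgm : AEStronglyMeasurable g (dunklMeasure k) := hg₂.2.1.1
  set Xe := eLpNorm g (ENNReal.ofReal q₂) (dunklMeasure k) with hXe
  set Ne := eLpNorm f (ENNReal.ofReal p₁) (dunklMeasure k) with hNe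
  set Be := eLpNorm (fun x => ((|x| ^ s : ℝ) : ℂ) * g x) (ENNReal.ofReal q₂) (dunklMeasure k)
    with hBe
  set c : ℝ := 1 / ((2 : ℝ) ^ (k + 1) * Real.Gamma (k + 2)) with hc
  have hc0 : 0 < c := by
    have := Real.Gamma_pos_of_pos (s := k + 2) (by linarith)
    positivity
  set A : ℝ := 1 / |M 0 1| ^ (k + 1) with hA
  have hA0 : 0 < A := by
    have := abs_pos.2 hb
    positivity
  set K : ℝ := c ^ ((q₁ - q₂) / q₁) * A ^ ((1 - 2 / q₁) * q₂) with hK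
  have hK0 : 0 ≤ K := by positivity
  have hconst : nashConst q₁ q₂ k (M 0 1) = (1 + K) ^ (1 / q₂) := rfl
  rw [hconst]
  have hD : 0 < (2 * k + 2) * (q₁ - q₂) + s * q₁ * q₂ := by
    have : 0 < q₁ - q₂ := sub_pos.2 hq
    positivity
  have hD2 : 0 < (2 * k + 2) * (q₁ - q₂) := mul_pos hk2 (sub_pos.2 hq)
  have hae : g =ᵐ[dunklMeasure k] 0 → Xe = 0 := fun h => by
    rw [hXe, eLpNorm_congr_ae h, eLpNorm_zero]
  have hNtop : Ne ≠ ∞ := hf₁.2.ne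
  -- Degenerate cases: `g = 0`, or an infinite weighted norm.
  rcases eq_or_ne Ne 0 with hN | hN
  · have h0 : eLpNorm g (ENNReal.ofReal q₁) (dunklMeasure k) = 0 := by
      rw [hN, mul_zero] at hHY
      exact le_antisymm hHY zero_le
    rw [eLpNorm_eq_zero_iff hgm (by simpa using hq₁0)] at h0
    rw [hae h0]
    exact zero_le
  rcases eq_or_ne Be 0 with hB | hB
  · have hwm : AEStronglyMeasurable (fun x => ((|x| ^ s : ℝ) : ℂ) * g x) (dunklMeasure k) := by
      refine AEStronglyMeasurable.mul (Measurable.aestronglyMeasurable ?_) hgm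
      fun_prop
    rw [hBe, eLpNorm_eq_zero_iff hwm (by simpa using hq₂0)] at hB
    have hne : ∀ᵐ x ∂(dunklMeasure k), x ≠ 0 :=
      (withDensity_absolutelyContinuous _ _).ae_le (Measure.ae_ne volume 0)
    have h0 : g =ᵐ[dunklMeasure k] 0 := by
      filter_upwards [hB, hne] with x hx hx0
      have hpos : 0 < |x| ^ s := Real.rpow_pos_of_pos (abs_pos.2 hx0) s
      have hpos' : ((|x| ^ s : ℝ) : ℂ) ≠ 0 := by exact_mod_cast hpos.ne'
      exact (mul_eq_zero.1 hx).resolve_left hpos'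
    rw [hae h0]
    exact zero_le
  rcases eq_or_ne Be ∞ with hBt | hBt
  · rw [hBt, ENNReal.top_rpow_of_pos (by positivity), ENNReal.mul_top]
    · exact le_top
    · refine mul_ne_zero ?_ ?_
      · have : (0 : ℝ) < (1 + K) ^ (1 / q₂) := by positivity
        simpa using this
      · simp [ENNReal.rpow_eq_zero_iff, hN, hNtop]
  -- The remaining case is an inequality between positive real numbers.
  have hXtop : Xe ≠ ∞ := hg₂.2.1.2.ne
  have hN0 : 0 < Ne.toReal := ENNReal.toReal_pos hN hNtop
  have hB0 : 0 < Be.toReal := ENNReal.toReal_pos hB hBt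
  have hα : 0 < (2 * k + 2) * (q₁ - q₂) / q₁ := by positivity
  have hβ : 0 < s * q₂ := by positivity
  have key := le_of_forall_radius_le (X := Xe.toReal) (N := Ne.toReal) (B := Be.toReal) (K := K)
    (q := q₂) (α := (2 * k + 2) * (q₁ - q₂) / q₁) (β := s * q₂) ENNReal.toReal_nonneg hN0 hB0 hK0
    hq₂0 hα hβ fun r hr => by
      have h := eLpNorm_rpow_le_radius hk hq₂0 hq.le hs hr hgm
      rw [← hXe, ← hBe] at h
      have h' : Xe ^ q₂ ≤ (ENNReal.ofReal (A ^ (1 - 2 / q₁)) * Ne *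
          ENNReal.ofReal (r ^ (2 * k + 2) * c) ^ (1 / q₂ - 1 / q₁)) ^ q₂ +
          (ENNReal.ofReal (r ^ (-s)) * Be) ^ q₂ := by
        refine h.trans ?_
        rw [hc, mul_one_div]
        gcongr
      have hexp : 0 ≤ 1 / q₂ - 1 / q₁ := sub_nonneg.2 (one_div_le_one_div_of_le hq₂0 hq.le)
      rw [← ENNReal.ofReal_toReal hXtop, ← ENNReal.ofReal_toReal hNtop,
        ← ENNReal.ofReal_toReal hBt, ENNReal.ofReal_rpow_of_nonneg (by positivity) hexp,
        ← ENNReal.ofReal_mul (by positivity), ← ENNReal.ofReal_mul (by positivity),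
        ← ENNReal.ofReal_mul (by positivity),
        ENNReal.ofReal_rpow_of_nonneg (by positivity) hq₂0.le,
        ENNReal.ofReal_rpow_of_nonneg (by positivity) hq₂0.le,
        ENNReal.ofReal_rpow_of_nonneg (by positivity) hq₂0.le,
        ← ENNReal.ofReal_add (by positivity) (by positivity),
        ENNReal.ofReal_le_ofReal_iff (by positivity)] at h'
      refine h'.trans (le_of_eq ?_)
      have he : (1 / q₂ - 1 / q₁) * q₂ = (q₁ - q₂) / q₁ := by
        field_simp
      have hvol : ((r ^ (2 * k + 2) * c) ^ (1 / q₂ - 1 / q₁)) ^ q₂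
          = r ^ ((2 * k + 2) * (q₁ - q₂) / q₁) * c ^ ((q₁ - q₂) / q₁) := by
        rw [← Real.rpow_mul (by positivity), he, Real.mul_rpow (by positivity) hc0.le,
          ← Real.rpow_mul hr.le, mul_div_assoc]
      rw [Real.mul_rpow (by positivity) (by positivity), Real.mul_rpow (by positivity)
        (by positivity), hvol, Real.mul_rpow (by positivity) (by positivity),
        ← Real.rpow_mul hA0.le, ← Real.rpow_mul hr.le, hK, neg_mul]
      ring
  have e1 : s * q₂ / ((2 * k + 2) * (q₁ - q₂) / q₁ + s * q₂)
      = s * q₁ * q₂ / ((2 * k + 2) * (q₁ - q₂) + s * q₁ * q₂) := by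
    field_simp
  have e2 : (2 * k + 2) * (q₁ - q₂) / q₁ / ((2 * k + 2) * (q₁ - q₂) / q₁ + s * q₂)
      = (2 * k + 2) * (q₁ - q₂) / ((2 * k + 2) * (q₁ - q₂) + s * q₁ * q₂) := by
    field_simp
  rw [e1, e2] at key
  rw [← ENNReal.ofReal_toReal hXtop, ← ENNReal.ofReal_toReal hNtop, ← ENNReal.ofReal_toReal hBt,
    ENNReal.ofReal_rpow_of_pos hN0, ENNReal.ofReal_rpow_of_pos hB0,
    ← ENNReal.ofReal_mul (by positivity), ← ENNReal.ofReal_mul (by positivity)]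
  exact ENNReal.ofReal_le_ofReal key
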